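/- Let $n\ge 0$ and let $H_1,H_2$ be $n\times n$ transfer matrices in $\mathcal{RH}_\infty$, i.e. matrices of real rational functions that are proper and have no pole in $\{\operatorname{Re}s\ge 0\}$; write $H_i(\infty)=\lim_{\omega\to\infty}H_i(j\omega)$. For $A\in\mathbb C^{n\times n}$ let $$\hat\alpha_{\max}(A)=\sup_{\|u\|=1,\ Au\neq 0}\arccos\frac{\operatorname{Re}\langle Au,u\rangle}{\|Au\|\,\|u\|}\in[0,\pi],\qquad \hat\alpha_{\max}(0)=0,$$ where $u$ ranges over $\mathbb C^n$ with the Euclidean norm. Suppose that $$\hat\alpha_{\max}(H_1(j\omega))+\hat\alpha_{\max}(H_2(j\omega))<\pi\qquad\text{for every }\omega\in[0,\infty],$$ where $H_i(j\infty)$ means $H_i(\infty)$. Then the negative feedback interconnection $y=H_1e$, $e=u-H_2y$ is $\mathcal L_2$-stable, for signals with values in $F^n$, $F\in\{\mathbb R,\mathbb C\}$: every input $u$ on $[0,\infty)$ that is square integrable on bounded intervals determines signals $e,y$ of the same kind, uniquely up to null sets, and there is $\gamma<\infty$ such that $u\in\mathcal L_2$ implies $e,y\in\mathcal L_2$ with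 $\|e\|\le\gamma\|u\|$ and $\|y\|\le\gamma\|u\|$. Here $H_i$ acts on $\mathcal L_2$ by multiplication of Laplace transforms in the open right half plane, and on locally square integrable signals by causality (truncation). No sectoriality assumption is made. -/

import Mathlib

open MeasureTheory

noncomputable section

namespace SmallPhase

/-! ### Real rational transfer matrices -/

/-- The transfer matrix `H` belongs to `RH∞`: every entry is a real rational function which is
proper and has no pole in the closed right half plane (`num` and `denom` are coprime). -/
def IsRHInfty {n : ℕ} (H : Matrix (Fin n) (Fin n) (RatFunc ℝ)) : Prop :=
  ∀ i j, (H i j).num.natDegree ≤ (H i j).denom.natDegree ∧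
    ∀ s : ℂ, 0 ≤ s.re → Polynomial.aeval s (H i j).denom ≠ 0

/-- The value `H(s)` at a complex number `s` (which is not a pole of `H`). -/
def evalAt {n : ℕ} (H : Matrix (Fin n) (Fin n) (RatFunc ℝ)) (s : ℂ) :
    Matrix (Fin n) (Fin n) ℂ :=
  Matrix.of fun i j => Polynomial.aeval s (H i j).num / Polynomial.aeval s (H i j).denom

/-- The value `H(∞) = lim_{ω → ∞} H(jω)` of a proper `H`: the direct feedthrough matrix. -/
def evalInfty {n : ℕ} (H : Matrix (Fin n) (Fin n) (RatFunc ℝ)) :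
    Matrix (Fin n) (Fin n) ℂ :=
  Matrix.of fun i j =>
    (((H i j).num.coeff (H i j).denom.natDegree / (H i j).denom.leadingCoeff : ℝ) : ℂ)

/-! ### The phase of a square matrix -/

/-- The angles between `u` and `A u`, for unit vectors `u` with `A u ≠ 0`. -/
def phaseSet {n : ℕ} (A : Matrix (Fin n) (Fin n) ℂ) : Set ℝ :=
  {θ | ∃ u : EuclideanSpace ℂ (Fin n), ‖u‖ = 1 ∧ ‖Matrix.toEuclideanCLM (𝕜 := ℂ) A u‖ ≠ 0 ∧
    θ = Real.arccos ((inner ℂ (Matrix.toEuclideanCLM (𝕜 := ℂ) A u) u).re /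
      (‖Matrix.toEuclideanCLM (𝕜 := ℂ) A u‖ * ‖u‖))}

/-- The maximum phase: the supremum of the angles in `phaseSet A`, a subset of `[0, π]`. It is `0`
if `A = 0`, since `sSup ∅ = 0`. -/
def maxPhase {n : ℕ} (A : Matrix (Fin n) (Fin n) ℂ) : ℝ := sSup (phaseSet A)

/-! ### Signals on the half line `[0, ∞)`

A signal is a function on `ℝ` of which only the restriction to `[0, ∞)` matters. -/

section Signals

variable {𝕜 : Type*} [RCLike 𝕜] {n : ℕ}

/-- Lebesgue measure on the time axis `[0, ∞)`. -/
def timeMeasure : Measure ℝ := volume.restrict (Set.Ici 0)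

/-- `u ∈ L₂ⁿ(𝕜)`. -/
def IsL2 (u : ℝ → EuclideanSpace 𝕜 (Fin n)) : Prop := MemLp u 2 timeMeasure

/-- The extended space `L₂ₑⁿ(𝕜)`: signals which are square integrable on every `[0, T]`. -/
def IsL2e (u : ℝ → EuclideanSpace 𝕜 (Fin n)) : Prop :=
  ∀ T : ℝ, MemLp u 2 (volume.restrict (Set.Icc 0 T))

/-- The Laplace transform `û(s) = ∫₀^∞ e^{-st} u(t) dt`. -/
def laplace (u : ℝ → EuclideanSpace 𝕜 (Fin n)) (s : ℂ) : Fin n → ℂ :=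
  fun i => ∫ t, Complex.exp (-(s * (t : ℂ))) * RCLike.map 𝕜 ℂ (u t i) ∂timeMeasure

/-- The truncation of a signal to `[0, T]`. -/
def truncate (T : ℝ) (u : ℝ → EuclideanSpace 𝕜 (Fin n)) : ℝ → EuclideanSpace 𝕜 (Fin n) :=
  (Set.Icc 0 T).indicator u

/-- For `u ∈ L₂`: the signal `y ∈ L₂` is the response `H u` of the system with transfer matrix `H`,
that is, `ŷ(s) = H(s) û(s)` in the open right half plane. -/
def IsL2Response (H : Matrix (Fin n) (Fin n) (RatFunc ℝ))
    (u y : ℝ → EuclideanSpace 𝕜 (Fin n)) : Prop :=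
  IsL2 y ∧ ∀ s : ℂ, 0 < s.re → laplace y s = (evalAt H s).mulVec (laplace u s)

/-- For `u ∈ L₂ₑ`: the signal `y` is the response `H u`, where the causal operator `H` on `L₂` is
extended to `L₂ₑ` by truncation: on every `[0, T]`, `y` agrees with the response to the
truncation of `u` to `[0, T]`. -/
def IsResponse (H : Matrix (Fin n) (Fin n) (RatFunc ℝ))
    (u y : ℝ → EuclideanSpace 𝕜 (Fin n)) : Prop :=
  ∀ T : ℝ, ∃ z : ℝ → EuclideanSpace 𝕜 (Fin n),
    IsL2Response H (truncate T u) z ∧ y =ᵐ[volume.restrict (Set.Icc 0 T)] z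

/-- The signals `e, y ∈ L₂ₑ` solve the negative feedback interconnection of `H₁` (forward path) and
`H₂` (feedback path) with external input `u`: `y = H₁ e` and `e = u - H₂ y`. -/
def IsLoopSolution (H₁ H₂ : Matrix (Fin n) (Fin n) (RatFunc ℝ))
    (u e y : ℝ → EuclideanSpace 𝕜 (Fin n)) : Prop :=
  IsL2e e ∧ IsL2e y ∧ IsResponse H₁ e y ∧
    ∃ w : ℝ → EuclideanSpace 𝕜 (Fin n), IsL2e w ∧ IsResponse H₂ y w ∧
      e =ᵐ[timeMeasure] fun t => u t - w t

end Signals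

/-- The negative feedback interconnection of `H₁` and `H₂` is `L₂`-stable (for signals with values
in `𝕜ⁿ`): every input `u ∈ L₂ₑ` determines the loop signals `e, y ∈ L₂ₑ`, uniquely up to null sets,
and every input `u ∈ L₂` produces `e, y ∈ L₂`, with a finite gain. -/
structure IsL2Stable (𝕜 : Type*) [RCLike 𝕜] {n : ℕ}
    (H₁ H₂ : Matrix (Fin n) (Fin n) (RatFunc ℝ)) : Prop where
  exists_solution : ∀ u : ℝ → EuclideanSpace 𝕜 (Fin n), IsL2e u →
    ∃ e y, IsLoopSolution H₁ H₂ u e y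
  unique_solution : ∀ u e y e' y' : ℝ → EuclideanSpace 𝕜 (Fin n), IsL2e u →
    IsLoopSolution H₁ H₂ u e y → IsLoopSolution H₁ H₂ u e' y' →
      e =ᵐ[timeMeasure] e' ∧ y =ᵐ[timeMeasure] y'
  finite_gain : ∃ γ : NNReal, ∀ u e y : ℝ → EuclideanSpace 𝕜 (Fin n), IsL2 u →
    IsLoopSolution H₁ H₂ u e y →
      IsL2 e ∧ IsL2 y ∧ eLpNorm e 2 timeMeasure ≤ γ * eLpNorm u 2 timeMeasure ∧
        eLpNorm y 2 timeMeasure ≤ γ * eLpNorm u 2 timeMeasure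

end SmallPhase

end

noncomputable section

namespace SmallPhase

open Polynomial Filter Topology
open scoped ENNReal NNReal

/-! ### Phases and invertibility -/

section Phase

variable {n : ℕ}

/-! The angle between nonzero vectors satisfies the triangle inequality. If `I + τ H₂ H₁` were
singular at some point of the extended imaginary axis with `τ ≥ 0`, a kernel vector `u` would be a
negative multiple of `H₂ H₁ u`. The angle between them would be `π`, yet it is at most the sum of
the two maximum phases (`det_one_add_smul_mul_ne_zero`).

For `τ ∈ [0, 1]` write `det (I + τ H₂ H₁) = P_τ / q` with a Hurwitz `q` independent of `τ`.
Invertibility at `∞` keeps the degree of `P_τ` equal to that of `q`, invertibility on the axis stops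
zeros from crossing it, and at `τ = 0` the determinant is `1`. So `P_1` is Hurwitz
(`aeval_ne_zero_of_homotopy`), `q / P_1` is proper and stable, and `I + H₂ H₁` is invertible over
the ring of proper stable functions (`isUnit_det_one_add_of_homotopy`).

In the time domain every matrix over this ring is the transfer matrix of a causal bounded operator
(`exists_matrixRealizes`), and an `L₂` signal is determined by its Laplace transform. Hence
algebraic identities between transfer matrices become identities between operators, first on `L₂`
and by causality on `L₂ₑ`. With `Ψ` realizing `(I + H₂ H₁)⁻¹`, the only loop solution is `e = Ψ u`,
`y = Φ₁ (Ψ u)` (`isL2Stable_of_isUnit`). -/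

lemma arccos_le_maxPhase (A : Matrix (Fin n) (Fin n) ℂ) (u : EuclideanSpace ℂ (Fin n))
    (hu : Matrix.toEuclideanCLM (𝕜 := ℂ) A u ≠ 0) :
    Real.arccos ((inner ℂ (Matrix.toEuclideanCLM (𝕜 := ℂ) A u) u).re /
      (‖Matrix.toEuclideanCLM (𝕜 := ℂ) A u‖ * ‖u‖)) ≤ maxPhase A := by
  have hu0 : u ≠ 0 := by rintro rfl; simp at hu
  have hn : 0 < ‖u‖ := norm_pos_iff.2 hu0
  have hn' : (‖u‖ : ℂ) ≠ 0 := by exact_mod_cast hn.ne'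
  have hA : 0 < ‖Matrix.toEuclideanCLM (𝕜 := ℂ) A u‖ := norm_pos_iff.2 hu
  refine le_csSup ⟨Real.pi, ?_⟩ ⟨((‖u‖⁻¹ : ℝ) : ℂ) • u, ?_, ?_, ?_⟩
  · rintro θ ⟨v, -, -, rfl⟩
    exact Real.arccos_le_pi _
  · rw [norm_smul, Complex.norm_real, norm_inv, norm_norm, inv_mul_cancel₀ hn.ne']
  · rw [map_smul, norm_smul, Complex.norm_real, norm_inv, norm_norm]
    positivity
  · congr 1
    rw [map_smul, norm_smul, norm_smul, inner_smul_left, inner_smul_right, Complex.conj_ofReal,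
      Complex.norm_real, norm_inv, norm_norm, Complex.re_ofReal_mul, Complex.re_ofReal_mul]
    field_simp

/-- If the maximum phases of `A` and `B` add up to less than `π`, then `B * A` has no negative
eigenvalue. -/
lemma det_one_add_smul_mul_ne_zero {A B : Matrix (Fin n) (Fin n) ℂ}
    (h : maxPhase A + maxPhase B < Real.pi) {τ : ℝ} (hτ : 0 ≤ τ) :
    (1 + (τ : ℂ) • (B * A)).det ≠ 0 := by
  intro hdet
  obtain ⟨v, hv0, hv⟩ := Matrix.exists_mulVec_eq_zero_iff.2 hdet
  -- For the real inner product `Re ⟨x, y⟩`, the angle of `InnerProductGeometry` is exactly the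
  -- arccosine in `phaseSet`, so its triangle inequality applies.
  let _ : InnerProductSpace ℝ (EuclideanSpace ℂ (Fin n)) :=
    InnerProductSpace.rclikeToReal ℂ (EuclideanSpace ℂ (Fin n))
  set u : EuclideanSpace ℂ (Fin n) := WithLp.toLp 2 v with hu
  set x := Matrix.toEuclideanCLM (𝕜 := ℂ) A u with hx
  set y := Matrix.toEuclideanCLM (𝕜 := ℂ) B x with hy
  have hu0 : u ≠ 0 := by simpa [hu] using hv0
  have huy : u = (-τ) • y := by
    rw [hy, hx, hu, Matrix.toEuclideanCLM_toLp, Matrix.toEuclideanCLM_toLp, ← WithLp.toLp_smul,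
      Matrix.mulVec_mulVec]
    congr 1
    rw [Matrix.add_mulVec, Matrix.one_mulVec, Matrix.smul_mulVec] at hv
    rw [neg_smul]
    exact eq_neg_of_add_eq_zero_left hv
  have hy0 : y ≠ 0 := by
    intro h0
    rw [h0, smul_zero] at huy
    exact hu0 huy
  have hτ0 : 0 < τ := by
    refine lt_of_le_of_ne hτ ?_
    rintro rfl
    rw [neg_zero, zero_smul] at huy
    exact hu0 huy
  have hx0 : x ≠ 0 := by
    intro h0
    rw [hy, h0, map_zero] at hy0
    exact hy0 rfl
  have h1 : InnerProductGeometry.angle x u ≤ maxPhase A := arccos_le_maxPhase A u hx0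
  have h2 : InnerProductGeometry.angle y x ≤ maxPhase B := arccos_le_maxPhase B x hy0
  have h3 := InnerProductGeometry.angle_le_angle_add_angle y x u
  have h4 : InnerProductGeometry.angle y u = Real.pi := by
    rw [huy, InnerProductGeometry.angle_smul_right_of_neg _ _ (neg_lt_zero.2 hτ0),
      InnerProductGeometry.angle_neg_right, InnerProductGeometry.angle_self hy0, sub_zero]
  linarith

end Phase

/-! ### Hurwitz polynomials -/

section Hurwitz

/-- Each factor satisfies `|s - r| ≥ Re s - Re r ≥ Re s`. The bound does not involve the roots, so
it survives a limit of polynomials. -/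
lemma pow_re_le_norm_multiset_prod (S : Multiset ℂ) (hS : ∀ r ∈ S, r.re < 0) {s : ℂ}
    (hs : 0 ≤ s.re) : s.re ^ S.card ≤ ‖(S.map fun r => s - r).prod‖ := by
  induction S using Multiset.induction with
  | empty => simp
  | cons r S ih =>
    have h1 : s.re ≤ ‖s - r‖ := by
      have := Complex.re_le_norm (s - r)
      have h2 := hS r (Multiset.mem_cons_self r S)
      simp only [Complex.sub_re] at this
      linarith
    have h2 := ih fun x hx => hS x (Multiset.mem_cons_of_mem hx)
    rw [Multiset.card_cons, Multiset.map_cons, Multiset.prod_cons, norm_mul, pow_succ']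
    gcongr

/-- Combining `-Re r ≤ |s - r|` with `|s| ≤ |s - r| + |r|` gives a constant per factor. The weight
`(1 + |s|) ^ d` makes the bound uniform on the unbounded half plane, as needed for stability under
perturbation. -/
lemma exists_mul_pow_le_norm_multiset_prod (S : Multiset ℂ) (hS : ∀ r ∈ S, r.re < 0) :
    ∃ k : ℝ, 0 < k ∧ ∀ s : ℂ, 0 ≤ s.re →
      k * (1 + ‖s‖) ^ S.card ≤ ‖(S.map fun r => s - r).prod‖ := by
  induction S using Multiset.induction with
  | empty => exact ⟨1, one_pos, by simp⟩
  | cons r S ih =>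
    obtain ⟨k, hk, h⟩ := ih fun x hx => hS x (Multiset.mem_cons_of_mem hx)
    have hr := hS r (Multiset.mem_cons_self r S)
    have hm : 0 < 1 + ‖r‖ - r.re := by linarith [norm_nonneg r]
    refine ⟨(-r.re / (1 + ‖r‖ - r.re)) * k, by have := div_pos (neg_pos.2 hr) hm; positivity,
      fun s hs => ?_⟩
    have h1 : -r.re / (1 + ‖r‖ - r.re) * (1 + ‖s‖) ≤ ‖s - r‖ := by
      have h2 : -r.re ≤ ‖s - r‖ := by
        have := Complex.re_le_norm (s - r)
        simp only [Complex.sub_re] at this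
        linarith
      have h3 : ‖s‖ ≤ ‖s - r‖ + ‖r‖ := by simpa using norm_add_le (s - r) r
      rw [div_mul_eq_mul_div, div_le_iff₀ hm]
      nlinarith [norm_nonneg r, norm_nonneg s, norm_nonneg (s - r)]
    rw [Multiset.card_cons, Multiset.map_cons, Multiset.prod_cons, norm_mul, pow_succ']
    calc _ = (-r.re / (1 + ‖r‖ - r.re) * (1 + ‖s‖)) * (k * (1 + ‖s‖) ^ S.card) := by ring
      _ ≤ _ := by
        gcongr
        exact h s hs

lemma aeval_eq_leadingCoeff_mul_prod_roots (p : ℝ[X]) (s : ℂ) :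
    aeval s p = (p.leadingCoeff : ℂ) *
      ((p.map (algebraMap ℝ ℂ)).roots.map fun r => s - r).prod := by
  rw [← eval_map_algebraMap, (IsAlgClosed.splits (p.map (algebraMap ℝ ℂ))).eval_eq_prod_roots,
    leadingCoeff_map]
  rfl

lemma card_roots_map_complex (p : ℝ[X]) :
    (p.map (algebraMap ℝ ℂ)).roots.card = p.natDegree := by
  rw [← (IsAlgClosed.splits (p.map (algebraMap ℝ ℂ))).natDegree_eq_card_roots, natDegree_map]

lemma re_neg_of_mem_roots {p : ℝ[X]} (hp : ∀ s : ℂ, 0 ≤ s.re → aeval s p ≠ 0) :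
    ∀ r ∈ (p.map (algebraMap ℝ ℂ)).roots, r.re < 0 := by
  intro r hr
  by_contra! h
  have := (mem_roots'.1 hr).2
  rw [IsRoot, eval_map_algebraMap] at this
  exact hp r h this

lemma leadingCoeff_mul_pow_re_le {p : ℝ[X]} (hp : ∀ s : ℂ, 0 ≤ s.re → aeval s p ≠ 0) {s : ℂ}
    (hs : 0 ≤ s.re) : |p.leadingCoeff| * s.re ^ p.natDegree ≤ ‖aeval s p‖ := by
  rw [aeval_eq_leadingCoeff_mul_prod_roots, norm_mul, Complex.norm_real, Real.norm_eq_abs,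
    ← card_roots_map_complex]
  gcongr
  exact pow_re_le_norm_multiset_prod _ (re_neg_of_mem_roots hp) hs

lemma exists_mul_pow_le_norm_aeval {p : ℝ[X]} (hp : ∀ s : ℂ, 0 ≤ s.re → aeval s p ≠ 0) :
    ∃ k : ℝ, 0 < k ∧ ∀ s : ℂ, 0 ≤ s.re → k * (1 + ‖s‖) ^ p.natDegree ≤ ‖aeval s p‖ := by
  obtain ⟨k, hk, h⟩ := exists_mul_pow_le_norm_multiset_prod _ (re_neg_of_mem_roots hp)
  have hp0 : p ≠ 0 := by rintro rfl; exact hp 0 le_rfl (by simp)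
  have hl : 0 < |p.leadingCoeff| := abs_pos.2 (leadingCoeff_ne_zero.2 hp0)
  refine ⟨|p.leadingCoeff| * k, by positivity, fun s hs => ?_⟩
  have := h s hs
  rw [card_roots_map_complex] at this
  rw [aeval_eq_leadingCoeff_mul_prod_roots, norm_mul, Complex.norm_real, Real.norm_eq_abs,
    mul_assoc]
  gcongr

lemma aeval_eq_sum_coeff {p : ℝ[X]} {d : ℕ} (hp : p.natDegree ≤ d) (s : ℂ) :
    aeval s p = ∑ k ∈ Finset.range (d + 1), (p.coeff k : ℂ) * s ^ k := by
  rw [aeval_eq_sum_range' (Nat.lt_succ_of_le hp)]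
  simp [Algebra.smul_def]

/-- The perturbation is measured against the same weight `(1 + |s|) ^ d` as the lower bound in
`exists_mul_pow_le_norm_aeval`, so close coefficients exclude zeros in the whole half plane at once.
-/
lemma norm_aeval_sub_aeval_le {p q : ℝ[X]} {d : ℕ} (hp : p.natDegree ≤ d) (hq : q.natDegree ≤ d)
    (s : ℂ) : ‖aeval s p - aeval s q‖ ≤
      (∑ k ∈ Finset.range (d + 1), |p.coeff k - q.coeff k|) * (1 + ‖s‖) ^ d := by
  rw [aeval_eq_sum_coeff hp, aeval_eq_sum_coeff hq, ← Finset.sum_sub_distrib, Finset.sum_mul]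
  refine norm_sum_le_of_le _ fun k hk => ?_
  rw [← sub_mul, norm_mul, norm_pow, ← Complex.ofReal_sub, Complex.norm_real, Real.norm_eq_abs]
  gcongr
  calc ‖s‖ ^ k ≤ (1 + ‖s‖) ^ k := by gcongr; linarith
    _ ≤ (1 + ‖s‖) ^ d := pow_le_pow_right₀ (by linarith [norm_nonneg s])
      (Nat.lt_succ_iff.1 (Finset.mem_range.1 hk))

/-- Along a path of polynomials of constant degree without zeros on the imaginary axis, the zeros
stay in the open left half plane. -/
lemma aeval_ne_zero_of_homotopy {P : ℝ → ℝ[X]} {d : ℕ} (hdeg : ∀ t, (P t).natDegree ≤ d)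
    (hcont : ∀ k, Continuous fun t => (P t).coeff k)
    (hlead : ∀ t ∈ Set.Icc (0 : ℝ) 1, (P t).coeff d ≠ 0)
    (haxis : ∀ t ∈ Set.Icc (0 : ℝ) 1, ∀ s : ℂ, s.re = 0 → aeval s (P t) ≠ 0)
    (hzero : ∀ s : ℂ, 0 ≤ s.re → aeval s (P 0) ≠ 0) :
    ∀ t ∈ Set.Icc (0 : ℝ) 1, ∀ s : ℂ, 0 ≤ s.re → aeval s (P t) ≠ 0 := by
  have hnd : ∀ t ∈ Set.Icc (0 : ℝ) 1, (P t).natDegree = d := fun t ht =>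
    le_antisymm (hdeg t) (le_natDegree_of_ne_zero (hlead t ht))
  have hcs : ∀ s : ℂ, Continuous fun t => aeval s (P t) := by
    intro s
    simp_rw [fun t => aeval_eq_sum_coeff (hdeg t) s]
    have := hcont
    fun_prop
  set G : Set ℝ := {t | ∀ s : ℂ, 0 ≤ s.re → aeval s (P t) ≠ 0} with hG
  -- Connectedness of `[0, 1]`: the good parameters form a closed set, contain `0`, and contain a
  -- neighbourhood of each of their points in `[0, 1)`.
  refine IsClosed.Icc_subset_of_forall_mem_nhdsWithin (s := G) ?_ hzero ?_
  · refine isClosed_of_closure_subset fun t ht => ?_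
    have htI : t ∈ Set.Icc (0 : ℝ) 1 :=
      closure_minimal Set.inter_subset_right isClosed_Icc ht
    refine ⟨fun s hs => ?_, htI⟩
    rcases hs.eq_or_lt with h0 | h0
    · exact haxis t htI s h0.symm
    -- Both sides are continuous in the parameter, so the root-free lower bound passes to the limit.
    -- It is positive because the degree does not drop.
    have hle : |(P t).coeff d| * s.re ^ d ≤ ‖aeval s (P t)‖ := by
      have hcl : IsClosed {t | |(P t).coeff d| * s.re ^ d ≤ ‖aeval s (P t)‖} :=
        isClosed_le (((hcont d).abs).mul continuous_const) (hcs s).norm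
      refine closure_minimal (fun x hx => ?_) hcl ht
      have := leadingCoeff_mul_pow_re_le hx.1 hs
      rwa [leadingCoeff, hnd x hx.2] at this
    have hpos : 0 < |(P t).coeff d| * s.re ^ d :=
      mul_pos (abs_pos.2 (hlead t htI)) (pow_pos h0 d)
    exact norm_pos_iff.1 (hpos.trans_le hle)
  · rintro t ⟨htG, htI⟩
    obtain ⟨k, hk, hkl⟩ := exists_mul_pow_le_norm_aeval htG
    rw [hnd t (Set.Ico_subset_Icc_self htI)] at hkl
    have hc : Continuous fun x => ∑ i ∈ Finset.range (d + 1), |(P x).coeff i - (P t).coeff i| := by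
      have := hcont
      fun_prop
    have hev : ∀ᶠ x in 𝓝 t, ∑ i ∈ Finset.range (d + 1), |(P x).coeff i - (P t).coeff i| < k := by
      refine hc.continuousAt.eventually_lt continuousAt_const ?_
      simpa using hk
    refine mem_nhdsWithin_of_mem_nhds (hev.mono fun x hx s hs h0 => ?_)
    have h1 := norm_aeval_sub_aeval_le (hdeg x) (hdeg t) s
    rw [h0, zero_sub, norm_neg] at h1
    have h2 := hkl s hs
    have h3 : 0 < (1 + ‖s‖) ^ d := by positivity
    nlinarith

end Hurwitz

/-! ### The ring of proper stable rational functions -/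

/-- The closed right half plane together with the point `∞`, which is `none`. -/
abbrev ClosedRHP : Type := Option {s : ℂ // 0 ≤ s.re}

/-- A polynomial all of whose zeros are in the open left half plane. -/
def IsHurwitz (q : ℝ[X]) : Prop := ∀ s : ℂ, 0 ≤ s.re → aeval s q ≠ 0

lemma IsHurwitz.ne_zero {q : ℝ[X]} (hq : IsHurwitz q) : q ≠ 0 := by
  rintro rfl
  exact hq 0 le_rfl (by simp)

lemma IsHurwitz.mul {q q' : ℝ[X]} (hq : IsHurwitz q) (hq' : IsHurwitz q') :
    IsHurwitz (q * q') := fun s hs => by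
  rw [map_mul]
  exact mul_ne_zero (hq s hs) (hq' s hs)

/-- The values of the rational function `p / q`, where `deg p ≤ deg q`. -/
def fracVal (p q : ℝ[X]) : ClosedRHP → ℂ
  | none => ((p.coeff q.natDegree / q.leadingCoeff : ℝ) : ℂ)
  | some s => aeval (s : ℂ) p / aeval (s : ℂ) q

lemma fracVal_self {q : ℝ[X]} (hq : IsHurwitz q) : fracVal q q = 1 := by
  funext x
  rcases x with _ | s
  · simp [fracVal, leadingCoeff_ne_zero.2 hq.ne_zero, div_self]
  · simp [fracVal, div_self (hq s.1 s.2)]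

/-- At `∞` the numerator is read at the degree of the denominator, whether or not it attains it;
properness makes this coefficient multiplicative. -/
lemma fracVal_mul {p p' q q' : ℝ[X]} (hq : IsHurwitz q) (hq' : IsHurwitz q')
    (hp : p.natDegree ≤ q.natDegree) (hp' : p'.natDegree ≤ q'.natDegree) :
    fracVal (p * p') (q * q') = fracVal p q * fracVal p' q' := by
  funext x
  rcases x with _ | s
  · simp only [fracVal, Pi.mul_apply]
    rw [natDegree_mul hq.ne_zero hq'.ne_zero, coeff_mul_add_eq_of_natDegree_le hp hp',
      leadingCoeff_mul, mul_div_mul_comm, Complex.ofReal_mul]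
  · simp [fracVal, mul_div_mul_comm]

lemma fracVal_add {p p' q q' : ℝ[X]} (hq : IsHurwitz q) (hq' : IsHurwitz q')
    (hp : p.natDegree ≤ q.natDegree) (hp' : p'.natDegree ≤ q'.natDegree) :
    fracVal (p * q' + q * p') (q * q') = fracVal p q + fracVal p' q' := by
  funext x
  rcases x with _ | s
  · simp only [fracVal, Pi.add_apply]
    have h := leadingCoeff_ne_zero.2 hq.ne_zero
    have h' := leadingCoeff_ne_zero.2 hq'.ne_zero
    rw [natDegree_mul hq.ne_zero hq'.ne_zero, coeff_add, coeff_mul_add_eq_of_natDegree_le hp le_rfl,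
      coeff_mul_add_eq_of_natDegree_le le_rfl hp', leadingCoeff_mul, ← Complex.ofReal_add,
      div_add_div _ _ h h']
    rfl
  · simp [fracVal, div_add_div _ _ (hq s.1 s.2) (hq' s.1 s.2)]

lemma fracVal_neg (p q : ℝ[X]) : fracVal (-p) q = -fracVal p q := by
  funext x
  rcases x with _ | s <;> simp [fracVal, neg_div]

lemma natDegree_mul_add_mul_le {p p' q q' : ℝ[X]} (hq : IsHurwitz q) (hq' : IsHurwitz q')
    (hp : p.natDegree ≤ q.natDegree) (hp' : p'.natDegree ≤ q'.natDegree) :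
    (p * q' + q * p').natDegree ≤ (q * q').natDegree := by
  rw [natDegree_mul hq.ne_zero hq'.ne_zero]
  exact natDegree_add_le_of_degree_le (natDegree_mul_le_of_le hp le_rfl)
    (natDegree_mul_le_of_le le_rfl hp')

lemma continuous_coeff_mul {T : Type} [TopologicalSpace T] {P Q : T → ℝ[X]}
    (hP : ∀ k, Continuous fun t => (P t).coeff k) (hQ : ∀ k, Continuous fun t => (Q t).coeff k)
    (k : ℕ) : Continuous fun t => (P t * Q t).coeff k := by
  simp_rw [coeff_mul]
  fun_prop

/-- Proper stable real rational functions, as functions on `ClosedRHP`, depending continuously on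
a parameter in the numerator. -/
def stableFrac (T : Type) [TopologicalSpace T] : Subring (T → ClosedRHP → ℂ) where
  carrier := {F | ∃ (q : ℝ[X]) (P : T → ℝ[X]), IsHurwitz q ∧
    (∀ t, (P t).natDegree ≤ q.natDegree) ∧ (∀ k, Continuous fun t => (P t).coeff k) ∧
    ∀ t, F t = fracVal (P t) q}
  zero_mem' := ⟨1, fun _ => 0, fun s _ => by simp, by simp, fun k => by fun_prop, fun t => by
    funext x
    rcases x with _ | s <;> simp [fracVal]⟩
  one_mem' := ⟨1, fun _ => 1, fun s _ => by simp, by simp, fun k => by fun_prop, fun t => by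
    funext x
    rcases x with _ | s <;> simp [fracVal]⟩
  add_mem' := by
    rintro F F' ⟨q, P, hq, hd, hc, hF⟩ ⟨q', P', hq', hd', hc', hF'⟩
    refine ⟨q * q', fun t => P t * q' + q * P' t, hq.mul hq',
      fun t => natDegree_mul_add_mul_le hq hq' (hd t) (hd' t), fun k => ?_, fun t => ?_⟩
    · simp_rw [coeff_add]
      exact (continuous_coeff_mul hc (fun _ => continuous_const) k).add
        (continuous_coeff_mul (fun _ => continuous_const) hc' k)
    · rw [fracVal_add hq hq' (hd t) (hd' t), ← hF, ← hF']
      rfl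
  mul_mem' := by
    rintro F F' ⟨q, P, hq, hd, hc, hF⟩ ⟨q', P', hq', hd', hc', hF'⟩
    refine ⟨q * q', fun t => P t * P' t, hq.mul hq', fun t => ?_,
      continuous_coeff_mul hc hc', fun t => ?_⟩
    · rw [natDegree_mul hq.ne_zero hq'.ne_zero]
      exact natDegree_mul_le_of_le (hd t) (hd' t)
    · rw [fracVal_mul hq hq' (hd t) (hd' t), ← hF, ← hF']
      rfl
  neg_mem' := by
    rintro F ⟨q, P, hq, hd, hc, hF⟩
    refine ⟨q, fun t => -P t, hq, fun t => by simpa using hd t, fun k => ?_, fun t => ?_⟩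
    · simp_rw [coeff_neg]
      exact (hc k).neg
    · rw [fracVal_neg, ← hF]
      rfl

/-- The homotopy parameter is itself an element of the ring, so `det (1 + t H₂ H₁)` is a single ring
element. -/
lemma ofReal_mem_stableFrac :
    (fun (t : ℝ) (_ : ClosedRHP) => (t : ℂ)) ∈ stableFrac ℝ := by
  refine ⟨1, fun t => C t, fun s _ => by simp, by simp, fun k => ?_, fun t => ?_⟩
  · simp_rw [coeff_C]
    split_ifs <;> fun_prop
  · funext x
    rcases x with _ | s <;> simp [fracVal]

/-- Evaluation of a family of stable rational functions. -/
def evalHom {T : Type} [TopologicalSpace T] (t : T) (x : ClosedRHP) : stableFrac T →+* ℂ :=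
  (Pi.evalRingHom (fun _ => ℂ) x).comp
    ((Pi.evalRingHom (fun _ => ClosedRHP → ℂ) t).comp (stableFrac T).subtype)

lemma evalHom_apply {T : Type} [TopologicalSpace T] (t : T) (x : ClosedRHP) (f : stableFrac T) :
    evalHom t x f = f.1 t x := rfl

lemma stableFrac_ext {f g : stableFrac Unit} (h : ∀ x, evalHom () x f = evalHom () x g) :
    f = g := by
  refine Subtype.ext ?_
  funext t x
  exact h x

section TransferMatrix

variable {n : ℕ} {H : Matrix (Fin n) (Fin n) (RatFunc ℝ)}

/-- A transfer matrix in `RH∞`, as a matrix over the ring of stable rational functions. -/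
def toStable (T : Type) [TopologicalSpace T] (hH : IsRHInfty H) :
    Matrix (Fin n) (Fin n) (stableFrac T) :=
  Matrix.of fun i j => ⟨fun _ => fracVal (H i j).num (H i j).denom, (H i j).denom,
    fun _ => (H i j).num, (hH i j).2, fun _ => (hH i j).1, fun _ => continuous_const, fun _ => rfl⟩

/-- The value of a transfer matrix at a point of the extended closed right half plane. -/
def evalRHP (H : Matrix (Fin n) (Fin n) (RatFunc ℝ)) : ClosedRHP → Matrix (Fin n) (Fin n) ℂ
  | none => evalInfty H
  | some s => evalAt H s

lemma mapMatrix_evalHom_toStable {T : Type} [TopologicalSpace T] (hH : IsRHInfty H) (t : T)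
    (x : ClosedRHP) : (evalHom t x).mapMatrix (toStable T hH) = evalRHP H x := by
  ext i j
  rcases x with _ | s <;> rfl

/-- The coefficients are real. This carries the phase condition from `ω ≥ 0` to negative
frequencies. -/
lemma evalAt_conj (H : Matrix (Fin n) (Fin n) (RatFunc ℝ)) (s : ℂ) :
    evalAt H (starRingEnd ℂ s) = (starRingEnd ℂ).mapMatrix (evalAt H s) := by
  ext i j
  simp [evalAt, aeval_conj]

lemma mapMatrix_smul_mul {R S : Type*} [CommRing R] [CommRing S] (f : R →+* S) (c : R)
    (A B : Matrix (Fin n) (Fin n) R) :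
    f.mapMatrix (c • (A * B)) = f c • (f.mapMatrix A * f.mapMatrix B) := by
  rw [← map_mul]
  ext i j
  exact map_mul f _ _

/-- If `I + τ H₂ H₁` is invertible on the extended imaginary axis for all `τ ∈ [0, 1]`, then
`I + H₂ H₁` has a stable proper inverse. -/
lemma isUnit_det_one_add_of_homotopy {H₁ H₂ : Matrix (Fin n) (Fin n) (RatFunc ℝ)}
    (h₁ : IsRHInfty H₁) (h₂ : IsRHInfty H₂)
    (hinf : ∀ t ∈ Set.Icc (0 : ℝ) 1, (1 + (t : ℂ) • (evalInfty H₂ * evalInfty H₁)).det ≠ 0)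
    (haxis : ∀ t ∈ Set.Icc (0 : ℝ) 1, ∀ s : ℂ, s.re = 0 →
      (1 + (t : ℂ) • (evalAt H₂ s * evalAt H₁ s)).det ≠ 0) :
    IsUnit (1 + toStable Unit h₂ * toStable Unit h₁).det := by
  set D := (1 + (⟨_, ofReal_mem_stableFrac⟩ : stableFrac ℝ) •
    (toStable ℝ h₂ * toStable ℝ h₁)).det with hD
  have hDv : ∀ t x, D.1 t x = (1 + (t : ℂ) • (evalRHP H₂ x * evalRHP H₁ x)).det := by
    intro t x
    rw [← evalHom_apply, hD, RingHom.map_det, map_add, map_one]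
    rw [mapMatrix_smul_mul, mapMatrix_evalHom_toStable, mapMatrix_evalHom_toStable]
    rfl
  -- Membership in the subring supplies the common denominator `q` and the continuous numerators `P
  -- t`; zeros of the determinant become zeros of `P t`.
  obtain ⟨q, P, hq, hdeg, hcont, hP⟩ := D.2
  have hlead : ∀ t ∈ Set.Icc (0 : ℝ) 1, (P t).coeff q.natDegree ≠ 0 := by
    intro t ht h0
    refine hinf t ht ?_
    have := hDv t none
    rw [hP, fracVal, h0, zero_div, Complex.ofReal_zero] at this
    exact this.symm
  have hst := aeval_ne_zero_of_homotopy hdeg hcont hlead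
    (fun t ht s hs h0 => by
      refine haxis t ht s hs ?_
      have := hDv t (some ⟨s, hs.ge⟩)
      rw [hP, fracVal, h0, zero_div] at this
      exact this.symm)
    (fun s hs h0 => by
      have := hDv 0 (some ⟨s, hs⟩)
      rw [hP, fracVal, h0, zero_div, Complex.ofReal_zero, zero_smul, add_zero,
        Matrix.det_one] at this
      exact zero_ne_one this)
    1 (by simp)
  have hnd : (P 1).natDegree = q.natDegree :=
    le_antisymm (hdeg 1) (le_natDegree_of_ne_zero (hlead 1 (by simp)))
  have hq1 : IsHurwitz (P 1) := hst
  -- The inverse is `q / P 1`: stable because `P 1` is Hurwitz, proper because the degrees agree.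
  refine IsUnit.of_mul_eq_one (⟨fun _ => fracVal q (P 1), P 1, fun _ => q, hq1,
    fun _ => hnd.ge, fun _ => continuous_const, fun _ => rfl⟩ : stableFrac Unit) ?_
  refine stableFrac_ext fun x => ?_
  have h1 : evalHom () x (1 + toStable Unit h₂ * toStable Unit h₁).det = fracVal (P 1) q x := by
    rw [← hP, hDv, RingHom.map_det, map_add, map_one, map_mul, mapMatrix_evalHom_toStable,
      mapMatrix_evalHom_toStable, Complex.ofReal_one, one_smul]
  rw [map_mul, map_one, h1, evalHom_apply]
  change (fracVal (P 1) q * fracVal q (P 1)) x = 1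
  rw [← fracVal_mul hq hq1 hnd.le hnd.ge, mul_comm, fracVal_self (hq.mul hq1)]
  rfl

lemma isUnit_one_add_of_maxPhase_add_lt {H₁ H₂ : Matrix (Fin n) (Fin n) (RatFunc ℝ)}
    (h₁ : IsRHInfty H₁) (h₂ : IsRHInfty H₂)
    (hphase : ∀ ω : ℝ, 0 ≤ ω →
      maxPhase (evalAt H₁ (Complex.I * (ω : ℂ))) +
        maxPhase (evalAt H₂ (Complex.I * (ω : ℂ))) < Real.pi)
    (hphase_infty : maxPhase (evalInfty H₁) + maxPhase (evalInfty H₂) < Real.pi) :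
    IsUnit (1 + toStable Unit h₂ * toStable Unit h₁) := by
  rw [Matrix.isUnit_iff_isUnit_det]
  refine isUnit_det_one_add_of_homotopy h₁ h₂
    (fun t ht => det_one_add_smul_mul_ne_zero hphase_infty ht.1) fun t ht s hs => ?_
  have hsI : s = Complex.I * (s.im : ℂ) := by
    apply Complex.ext <;> simp [hs]
  rcases le_total 0 s.im with h0 | h0
  · rw [hsI]
    exact det_one_add_smul_mul_ne_zero (hphase _ h0) ht.1
  · have hsc : s = starRingEnd ℂ (Complex.I * ((-s.im : ℝ) : ℂ)) := by
      apply Complex.ext <;> simp [hs]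
    have hne := det_one_add_smul_mul_ne_zero (hphase _ (neg_nonneg.2 h0)) ht.1
    rw [hsc]
    have key := mapMatrix_smul_mul (starRingEnd ℂ) (t : ℂ)
      (evalAt H₂ (Complex.I * ((-s.im : ℝ) : ℂ))) (evalAt H₁ (Complex.I * ((-s.im : ℝ) : ℂ)))
    rw [Complex.conj_ofReal] at key
    rw [evalAt_conj, evalAt_conj, ← key, ← map_one (starRingEnd ℂ).mapMatrix, ← map_add,
      ← RingHom.map_det]
    exact (_root_.map_ne_zero _).2 hne

end TransferMatrix

/-! ### Laplace transforms of scalar signals -/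

section ScalarLaplace

variable {𝕜 : Type*} [RCLike 𝕜]

/-- The Laplace transform of a scalar signal. -/
def scalarLaplace (u : ℝ → 𝕜) (s : ℂ) : ℂ :=
  ∫ t, Complex.exp (-(s * (t : ℂ))) * RCLike.map 𝕜 ℂ (u t) ∂timeMeasure

lemma timeMeasure_eq_restrict_Ioi : timeMeasure = volume.restrict (Set.Ioi 0) :=
  (Measure.restrict_congr_set Ioi_ae_eq_Ici).symm

instance : SigmaFinite timeMeasure := by unfold timeMeasure; infer_instance

lemma integrable_exp_mul {a : ℂ} (ha : a.re < 0) :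
    Integrable (fun t : ℝ => Complex.exp (a * t)) timeMeasure := by
  rw [timeMeasure_eq_restrict_Ioi]
  exact integrableOn_exp_mul_complex_Ioi ha 0

lemma integral_exp_mul {a : ℂ} (ha : a.re < 0) :
    ∫ t : ℝ, Complex.exp (a * t) ∂timeMeasure = -a⁻¹ := by
  rw [timeMeasure_eq_restrict_Ioi, integral_exp_mul_complex_Ioi ha 0]
  simp [neg_div]

lemma memLp_exp_mul {a : ℂ} (ha : a.re < 0) :
    MemLp (fun t : ℝ => Complex.exp (a * t)) 2 timeMeasure := by
  rw [memLp_two_iff_integrable_sq_norm (by fun_prop)]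
  have h := (integrable_exp_mul (a := 2 * a)
    (by rw [two_mul, Complex.add_re]; linarith)).norm
  refine h.congr (ae_of_all _ fun t => ?_)
  simp only [Complex.norm_exp]
  rw [sq, ← Real.exp_add]
  congr 1
  rw [mul_assoc, two_mul, Complex.add_re]

lemma memLp_map {𝕜' : Type*} [RCLike 𝕜'] {u : ℝ → 𝕜} (hu : MemLp u 2 timeMeasure) :
    MemLp (fun t => RCLike.map 𝕜 𝕜' (u t)) 2 timeMeasure :=
  (RCLike.map 𝕜 𝕜').comp_memLp' hu

lemma integrable_exp_neg_mul {u : ℝ → ℂ} (hu : MemLp u 2 timeMeasure) {s : ℂ} (hs : 0 < s.re) :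
    Integrable (fun t : ℝ => Complex.exp (-(s * t)) * u t) timeMeasure := by
  have h := (memLp_exp_mul (a := -s) (by simpa using hs)).integrable_mul hu
  refine h.congr (ae_of_all _ fun t => ?_)
  simp

lemma scalarLaplace_complex (u : ℝ → ℂ) (s : ℂ) :
    scalarLaplace u s = ∫ t : ℝ, Complex.exp (-(s * t)) * u t ∂timeMeasure := by
  simp [scalarLaplace]

lemma scalarLaplace_add {u v : ℝ → 𝕜} (hu : MemLp u 2 timeMeasure) (hv : MemLp v 2 timeMeasure)
    {s : ℂ} (hs : 0 < s.re) :
    scalarLaplace (fun t => u t + v t) s = scalarLaplace u s + scalarLaplace v s := by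
  simp only [scalarLaplace, map_add, mul_add]
  exact integral_add (integrable_exp_neg_mul (memLp_map hu) hs)
    (integrable_exp_neg_mul (memLp_map hv) hs)

lemma scalarLaplace_sum {ι : Type*} (S : Finset ι) {u : ι → ℝ → 𝕜}
    (hu : ∀ i ∈ S, MemLp (u i) 2 timeMeasure) {s : ℂ} (hs : 0 < s.re) :
    scalarLaplace (fun t => ∑ i ∈ S, u i t) s = ∑ i ∈ S, scalarLaplace (u i) s := by
  simp only [scalarLaplace, map_sum, Finset.mul_sum]
  exact integral_finsetSum _ fun i hi => integrable_exp_neg_mul (memLp_map (hu i hi)) hs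

lemma scalarLaplace_const_mul (c : ℂ) (u : ℝ → ℂ) (s : ℂ) :
    scalarLaplace (fun t => c * u t) s = c * scalarLaplace u s := by
  rw [scalarLaplace_complex, scalarLaplace_complex, ← integral_const_mul]
  congr 1
  funext t
  ring

lemma scalarLaplace_conj (u : ℝ → ℂ) (s : ℂ) :
    scalarLaplace (fun t => starRingEnd ℂ (u t)) s =
      starRingEnd ℂ (scalarLaplace u (starRingEnd ℂ s)) := by
  rw [scalarLaplace_complex, scalarLaplace_complex, ← integral_conj]
  congr 1
  funext t
  rw [map_mul, ← Complex.exp_conj]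
  simp

/-- An integrable function whose Fourier transform vanishes is zero: the real case. -/
lemma ae_eq_zero_of_fourier_eq_zero_real {μ : Measure ℝ} {g : ℝ → ℝ} (hg : Integrable g μ)
    (h : ∀ ω : ℝ, ∫ x : ℝ, Complex.exp (ω * x * Complex.I) * (g x : ℂ) ∂μ = 0) :
    g =ᵐ[μ] 0 := by
  have hfin : ∀ {f : ℝ → ℝ}, Integrable f μ →
      IsFiniteMeasure (μ.withDensity fun x => ENNReal.ofReal (f x)) := fun hf =>
    isFiniteMeasure_withDensity_ofReal hf.2
  have := hfin hg
  have := hfin hg.neg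
  have hchar : ∀ {f : ℝ → ℝ}, Integrable f μ → ∀ ω : ℝ,
      charFun (μ.withDensity fun x => ENNReal.ofReal (f x)) ω =
        ∫ x : ℝ, Complex.exp (ω * x * Complex.I) * ((max (f x) 0 : ℝ) : ℂ) ∂μ := by
    intro f hf ω
    rw [charFun_apply_real, integral_withDensity_eq_integral_toReal_smul₀
      hf.aemeasurable.ennreal_ofReal (by simp)]
    congr 1
    funext x
    rw [ENNReal.toReal_ofReal', Complex.real_smul, mul_comm]
  have hint : ∀ {f : ℝ → ℝ}, Integrable f μ → ∀ ω : ℝ,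
      Integrable (fun x : ℝ => Complex.exp (ω * x * Complex.I) * ((max (f x) 0 : ℝ) : ℂ)) μ := by
    intro f hf ω
    refine (hf.pos_part.ofReal (𝕜 := ℂ)).bdd_mul (c := 1) (by fun_prop) (ae_of_all _ fun x => ?_)
    rw [← Complex.ofReal_mul, Complex.norm_exp_ofReal_mul_I]
  -- The positive and negative parts of `g` are densities of finite measures with equal
  -- characteristic functions, since the difference of these is the transform of `g`.
  have heq : (μ.withDensity fun x => ENNReal.ofReal (g x)) =
      μ.withDensity fun x => ENNReal.ofReal ((-g) x) := by
    refine Measure.ext_of_charFun (funext fun ω => ?_)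
    rw [hchar hg, hchar hg.neg, ← sub_eq_zero, ← integral_sub (hint hg ω) (hint hg.neg ω), ← h ω]
    congr 1
    funext x
    rw [← mul_sub, ← Complex.ofReal_sub]
    congr 2
    rw [Pi.neg_apply]
    rcases le_total (g x) 0 with h0 | h0
    · rw [max_eq_right h0, max_eq_left (by linarith)]; ring
    · rw [max_eq_left h0, max_eq_right (by linarith)]; ring
  have hae := (withDensity_eq_iff hg.aemeasurable.ennreal_ofReal
    hg.neg.aemeasurable.ennreal_ofReal hg.lintegral_lt_top.ne).1 heq
  filter_upwards [hae] with x hx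
  have h1 := congrArg ENNReal.toReal hx
  rw [ENNReal.toReal_ofReal', ENNReal.toReal_ofReal', Pi.neg_apply] at h1
  rcases le_total (g x) 0 with h0 | h0
  · rw [max_eq_right h0, max_eq_left (by linarith)] at h1
    simpa using h1.symm
  · rw [max_eq_left h0, max_eq_right (by linarith)] at h1
    simpa using h1

/-- The transform of the conjugate of `g` at `ω` is the conjugate of that of `g` at `-ω`, so it
vanishes too, and with it the transform of `Re g`. -/
lemma re_ae_eq_zero_of_fourier_eq_zero {μ : Measure ℝ} {g : ℝ → ℂ} (hg : Integrable g μ)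
    (h : ∀ ω : ℝ, ∫ x : ℝ, Complex.exp (ω * x * Complex.I) * g x ∂μ = 0) :
    ∀ᵐ x ∂μ, (g x).re = 0 := by
  refine ae_eq_zero_of_fourier_eq_zero_real hg.re fun ω => ?_
  have hint : ∀ {f : ℝ → ℂ}, Integrable f μ →
      Integrable (fun x : ℝ => Complex.exp (ω * x * Complex.I) * f x) μ := fun hf => by
    refine hf.bdd_mul (c := 1) (by fun_prop) (ae_of_all _ fun x => ?_)
    rw [← Complex.ofReal_mul, Complex.norm_exp_ofReal_mul_I]
  have hc : ∫ x : ℝ, Complex.exp (ω * x * Complex.I) * starRingEnd ℂ (g x) ∂μ = 0 := by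
    rw [← map_zero (starRingEnd ℂ), ← h (-ω), ← integral_conj]
    congr 1
    funext x
    rw [map_mul, ← Complex.exp_conj]
    simp
  have hgc : Integrable (fun x => starRingEnd ℂ (g x)) μ :=
    (Complex.conjCLE.toContinuousLinearMap).integrable_comp hg
  have hsum := integral_add (hint hg) (hint hgc)
  rw [h ω, hc, add_zero] at hsum
  rw [← mul_zero (2⁻¹ : ℂ), ← hsum, ← integral_const_mul]
  congr 1
  funext x
  rw [← mul_add, Complex.add_conj]
  push_cast
  ring

/-- An integrable function whose Fourier transform vanishes is zero. -/
lemma ae_eq_zero_of_fourier_eq_zero {μ : Measure ℝ} {g : ℝ → ℂ} (hg : Integrable g μ)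
    (h : ∀ ω : ℝ, ∫ x : ℝ, Complex.exp (ω * x * Complex.I) * g x ∂μ = 0) : g =ᵐ[μ] 0 := by
  have h1 := re_ae_eq_zero_of_fourier_eq_zero hg h
  have h2 := re_ae_eq_zero_of_fourier_eq_zero (hg.const_mul (-Complex.I)) fun ω => by
    rw [← mul_zero (-Complex.I), ← h ω, ← integral_const_mul]
    congr 1
    funext x
    ring
  filter_upwards [h1, h2] with x hx hx'
  apply Complex.ext
  · simpa using hx
  · simpa using hx'

lemma map_complex_injective : Function.Injective (RCLike.map 𝕜 ℂ) := by
  intro x y hxy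
  have h1 := congrArg Complex.re hxy
  have h2 := congrArg Complex.im hxy
  simp at h1 h2
  exact RCLike.ext h1 h2

/-- A square integrable signal is determined by its Laplace transform. -/
lemma ae_eq_zero_of_scalarLaplace_eq_zero {u : ℝ → 𝕜} (hu : MemLp u 2 timeMeasure)
    (h : ∀ s : ℂ, 0 < s.re → scalarLaplace u s = 0) : u =ᵐ[timeMeasure] 0 := by
  -- On the line `Re s = 1` the Laplace transform is the Fourier transform of the integrable
  -- function `e^{-t} u(t)`.
  have hint := integrable_exp_neg_mul (memLp_map (𝕜' := ℂ) hu) (s := 1) one_pos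
  have := ae_eq_zero_of_fourier_eq_zero hint fun ω => by
    rw [← h (1 - ω * Complex.I) (by simp), scalarLaplace]
    congr 1
    funext x
    rw [← mul_assoc, ← Complex.exp_add]
    congr 2
    ring
  filter_upwards [this] with x hx
  have hx' : RCLike.map 𝕜 ℂ (u x) = 0 := by simpa using hx
  exact map_complex_injective (by rw [hx', Pi.zero_apply, map_zero])

end ScalarLaplace

/-! ### Convolution with an integrable kernel -/

/-- Young's inequality for the convolution of an `L²` function with an `L¹` function. -/
lemma eLpNorm_convolution_le {f g : ℝ → ℂ} (hf : AEStronglyMeasurable f) (hg : Measurable g) :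
    eLpNorm (fun t => ∫ x, f x * g (t - x)) 2 volume ≤
      (∫⁻ x, ‖g x‖ₑ) * eLpNorm f 2 volume := by
  set K := ∫⁻ x, ‖g x‖ₑ with hK
  -- Cauchy–Schwarz for the splitting `|f| |g| = (|f| |g|^{1/2}) · |g|^{1/2}`; Tonelli and
  -- translation invariance then give the second factor `K`.
  have hpt : ∀ t, ‖∫ x, f x * g (t - x)‖ₑ ^ 2 ≤ K * ∫⁻ x, ‖f x‖ₑ ^ 2 * ‖g (t - x)‖ₑ := by
    intro t
    have hgm : AEMeasurable fun x => ‖g (t - x)‖ₑ := by fun_prop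
    have hfm : AEMeasurable fun x => ‖f x‖ₑ := hf.enorm
    have h1 : ‖∫ x, f x * g (t - x)‖ₑ ≤
        (∫⁻ x, ‖f x‖ₑ ^ 2 * ‖g (t - x)‖ₑ) ^ (2⁻¹ : ℝ) * (∫⁻ x, ‖g (t - x)‖ₑ) ^ (2⁻¹ : ℝ) := by
      refine (enorm_integral_le_lintegral_enorm _).trans ?_
      refine le_trans (le_of_eq ?_) (ENNReal.lintegral_mul_norm_pow_le
        ((hfm.pow_const 2).mul hgm) hgm (p := 2⁻¹) (q := 2⁻¹) (by norm_num) (by norm_num)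
        (by norm_num))
      congr 1
      funext x
      rw [Pi.mul_apply, ENNReal.mul_rpow_of_nonneg _ _ (by norm_num), mul_assoc,
        ← ENNReal.rpow_add_of_nonneg _ _ (by norm_num) (by norm_num), enorm_mul,
        ← ENNReal.rpow_natCast, ← ENNReal.rpow_mul]
      norm_num
    rw [lintegral_sub_left_eq_self (fun x => ‖g x‖ₑ) t, ← hK] at h1
    calc _ ≤ _ := pow_le_pow_left' h1 2
      _ = _ := by
        rw [mul_pow, ← ENNReal.rpow_natCast, ← ENNReal.rpow_natCast, ← ENNReal.rpow_mul,
          ← ENNReal.rpow_mul]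
        norm_num
        rw [mul_comm]
  have hsq : ∀ h : ℝ → ℂ, eLpNorm h 2 volume ^ 2 = ∫⁻ x, ‖h x‖ₑ ^ 2 := by
    intro h
    have := eLpNorm_nnreal_pow_eq_lintegral (f := h) (μ := volume) (p := 2) (by norm_num)
    simpa using this
  refine (ENNReal.pow_le_pow_left_iff two_ne_zero).1 ?_
  rw [mul_pow, hsq, hsq]
  have hmeas : AEMeasurable (Function.uncurry fun t x : ℝ => ‖f x‖ₑ ^ 2 * ‖g (t - x)‖ₑ)
      ((volume : Measure ℝ).prod volume) := by
    have h1 : AEMeasurable (fun p : ℝ × ℝ => ‖f p.2‖ₑ) ((volume : Measure ℝ).prod volume) :=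
      (AEStronglyMeasurable.comp_snd hf).enorm
    have h2 : AEMeasurable (fun p : ℝ × ℝ => ‖g (p.1 - p.2)‖ₑ)
      ((volume : Measure ℝ).prod volume) := by fun_prop
    exact (h1.pow_const 2).mul h2
  calc ∫⁻ t, ‖∫ x, f x * g (t - x)‖ₑ ^ 2
      ≤ ∫⁻ t, K * ∫⁻ x, ‖f x‖ₑ ^ 2 * ‖g (t - x)‖ₑ := lintegral_mono hpt
    _ = K * ∫⁻ t, ∫⁻ x, ‖f x‖ₑ ^ 2 * ‖g (t - x)‖ₑ :=
        lintegral_const_mul'' _ hmeas.lintegral_prod_right'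
    _ = K * ∫⁻ x, ∫⁻ t, ‖f x‖ₑ ^ 2 * ‖g (t - x)‖ₑ := by rw [lintegral_lintegral_swap hmeas]
    _ = K * ∫⁻ x, ‖f x‖ₑ ^ 2 * K := by
        congr 2
        funext x
        rw [lintegral_const_mul _ (by fun_prop), lintegral_sub_right_eq_self (fun t => ‖g t‖ₑ) x]
    _ = K ^ 2 * ∫⁻ x, ‖f x‖ₑ ^ 2 := by
        rw [lintegral_mul_const'' _ (hf.enorm.pow_const 2)]
        ring

/-! ### Realization of scalar transfer functions -/

section Realization

variable {𝕜 : Type*} [RCLike 𝕜]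

/-- The operator `Φ` on scalar signals is causal, bounded on `L₂`, and acts as multiplication of
Laplace transforms by `g`. -/
structure Realizes (g : ℂ → ℂ) (Φ : (ℝ → 𝕜) → ℝ → 𝕜) : Prop where
  causal : ∀ (T : ℝ) (u v : ℝ → 𝕜), u =ᵐ[volume.restrict (Set.Icc 0 T)] v →
    Φ u =ᵐ[volume.restrict (Set.Icc 0 T)] Φ v
  bounded : ∃ C : ℝ≥0, ∀ u, MemLp u 2 timeMeasure → MemLp (Φ u) 2 timeMeasure ∧
    eLpNorm (Φ u) 2 timeMeasure ≤ C * eLpNorm u 2 timeMeasure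
  laplace_eq : ∀ u, MemLp u 2 timeMeasure → ∀ s : ℂ, 0 < s.re →
    scalarLaplace (Φ u) s = g s * scalarLaplace u s

/-- `g` is the transfer function of a causal bounded operator. -/
def IsRealizable (𝕜 : Type*) [RCLike 𝕜] (g : ℂ → ℂ) : Prop :=
  ∃ Φ : (ℝ → 𝕜) → ℝ → 𝕜, Realizes g Φ

lemma Realizes.memLp {g : ℂ → ℂ} {Φ : (ℝ → 𝕜) → ℝ → 𝕜} (h : Realizes g Φ) {u : ℝ → 𝕜}
    (hu : MemLp u 2 timeMeasure) : MemLp (Φ u) 2 timeMeasure :=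
  h.bounded.elim fun _ hC => (hC u hu).1

lemma IsRealizable.congr {g g' : ℂ → ℂ} (h : IsRealizable 𝕜 g)
    (hg : ∀ s : ℂ, 0 < s.re → g' s = g s) : IsRealizable 𝕜 g' := by
  obtain ⟨Φ, h⟩ := h
  exact ⟨Φ, h.causal, h.bounded, fun u hu s hs => by rw [hg s hs, h.laplace_eq u hu s hs]⟩

lemma isRealizable_const (c : ℂ) : IsRealizable ℂ fun _ => c := by
  refine ⟨fun u t => c * u t, ⟨fun T u v h => ?_, ⟨‖c‖₊, fun u hu => ⟨hu.const_mul c, ?_⟩⟩,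
    fun u _ s _ => scalarLaplace_const_mul c u s⟩⟩
  · filter_upwards [h] with t ht
    rw [ht]
  · exact (eLpNorm_const_smul c u 2 timeMeasure).le

lemma IsRealizable.add {g g' : ℂ → ℂ} (h : IsRealizable 𝕜 g) (h' : IsRealizable 𝕜 g') :
    IsRealizable 𝕜 fun s => g s + g' s := by
  obtain ⟨Φ, h⟩ := h
  obtain ⟨Φ', h'⟩ := h'
  refine ⟨fun u t => Φ u t + Φ' u t, ⟨fun T u v huv => ?_, ?_, fun u hu s hs => ?_⟩⟩
  · filter_upwards [h.causal T u v huv, h'.causal T u v huv] with t h1 h2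
    rw [h1, h2]
  · obtain ⟨C, hC⟩ := h.bounded
    obtain ⟨C', hC'⟩ := h'.bounded
    refine ⟨C + C', fun u hu => ⟨(hC u hu).1.add (hC' u hu).1, ?_⟩⟩
    refine (eLpNorm_add_le (hC u hu).1.1 (hC' u hu).1.1 one_le_two).trans ?_
    rw [ENNReal.coe_add, add_mul]
    exact add_le_add (hC u hu).2 (hC' u hu).2
  · rw [scalarLaplace_add (h.memLp hu) (h'.memLp hu) hs, h.laplace_eq u hu s hs,
      h'.laplace_eq u hu s hs, add_mul]

lemma IsRealizable.mul {g g' : ℂ → ℂ} (h : IsRealizable 𝕜 g) (h' : IsRealizable 𝕜 g') :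
    IsRealizable 𝕜 fun s => g s * g' s := by
  obtain ⟨Φ, h⟩ := h
  obtain ⟨Φ', h'⟩ := h'
  refine ⟨fun u => Φ (Φ' u), ⟨fun T u v huv => h.causal T _ _ (h'.causal T u v huv), ?_,
    fun u hu s hs => ?_⟩⟩
  · obtain ⟨C, hC⟩ := h.bounded
    obtain ⟨C', hC'⟩ := h'.bounded
    refine ⟨C * C', fun u hu => ⟨(hC _ (hC' u hu).1).1, ?_⟩⟩
    refine (hC _ (hC' u hu).1).2.trans ?_
    rw [ENNReal.coe_mul, mul_assoc]
    gcongr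
    exact (hC' u hu).2
  · rw [h.laplace_eq _ (h'.memLp hu) s hs, h'.laplace_eq u hu s hs, mul_assoc]

/-- The response of the system with transfer function `1 / (s - r)`. -/
def firstOrder (r : ℂ) (u : ℝ → ℂ) (t : ℝ) : ℂ :=
  ∫ x in Set.Icc 0 t, u x * Complex.exp (r * ((t - x : ℝ) : ℂ))

lemma firstOrder_eq_convolution (r : ℂ) (u : ℝ → ℂ) (t : ℝ) :
    firstOrder r u t = ∫ x, (Set.Ici 0).indicator u x *
      (Set.Ici 0).indicator (fun y : ℝ => Complex.exp (r * y)) (t - x) := by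
  rw [firstOrder, ← integral_indicator measurableSet_Icc]
  congr 1
  funext x
  by_cases h1 : 0 ≤ x <;> by_cases h2 : x ≤ t <;> simp [Set.indicator, h1, h2]

lemma lintegral_enorm_exp_lt_top {r : ℂ} (hr : r.re < 0) :
    ∫⁻ x, ‖(Set.Ici 0).indicator (fun y : ℝ => Complex.exp (r * y)) x‖ₑ < ∞ := by
  have h := (integrable_indicator_iff measurableSet_Ici).2 (integrable_exp_mul hr)
  exact h.2

/-- The weight `e^{-st}` distributes over the convolution. The integral of a convolution is the
product of the integrals, and the kernel `e^{(r-s)t}` integrates to `1 / (s - r)`. -/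
lemma scalarLaplace_firstOrder {r : ℂ} (hr : r.re < 0) {u : ℝ → ℂ} (hu : MemLp u 2 timeMeasure)
    {s : ℂ} (hs : 0 < s.re) :
    scalarLaplace (firstOrder r u) s = (s - r)⁻¹ * scalarLaplace u s := by
  have hrs : (r - s).re < 0 := by rw [Complex.sub_re]; linarith
  have hf : Integrable ((Set.Ici 0).indicator fun t : ℝ => Complex.exp (-(s * t)) * u t) :=
    (integrable_indicator_iff measurableSet_Ici).2 (integrable_exp_neg_mul hu hs)
  have hg : Integrable ((Set.Ici 0).indicator fun t : ℝ => Complex.exp ((r - s) * t)) :=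
    (integrable_indicator_iff measurableSet_Ici).2 (integrable_exp_mul hrs)
  have hconv := integral_convolution (ContinuousLinearMap.mul ℂ ℂ) hf hg
  rw [integral_indicator measurableSet_Ici, integral_indicator measurableSet_Ici] at hconv
  have h2 := integral_exp_mul hrs
  rw [timeMeasure] at h2
  rw [h2, ContinuousLinearMap.mul_apply', mul_comm, ← inv_neg, neg_sub] at hconv
  rw [scalarLaplace_complex, scalarLaplace_complex, timeMeasure]
  rw [← hconv, ← integral_indicator measurableSet_Ici]
  congr 1
  funext t
  rw [convolution_mul]
  by_cases ht : 0 ≤ t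
  · rw [Set.indicator_of_mem (by exact ht), firstOrder_eq_convolution, ← integral_const_mul]
    congr 1
    funext x
    by_cases h1 : 0 ≤ x <;> by_cases h3 : x ≤ t <;> simp [Set.indicator, h1, h3]
    have he : Complex.exp (-(s * t)) * Complex.exp (r * (t - x)) =
        Complex.exp (-(s * x)) * Complex.exp ((r - s) * (t - x)) := by
      rw [← Complex.exp_add, ← Complex.exp_add]
      congr 1
      ring
    linear_combination u x * he
  · rw [Set.indicator_of_notMem (by exact ht), integral_eq_zero_of_ae]
    refine ae_of_all _ fun x => ?_
    by_cases h1 : 0 ≤ x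
    · have : ¬ x ≤ t := fun h => ht (h1.trans h)
      simp [Set.indicator, this]
    · simp [Set.indicator, h1]

lemma realizes_firstOrder {r : ℂ} (hr : r.re < 0) :
    Realizes (fun s => (s - r)⁻¹) (firstOrder r) where
  causal T u v huv := by
    filter_upwards [ae_restrict_mem measurableSet_Icc] with t ht
    refine integral_congr_ae ?_
    filter_upwards [ae_restrict_of_ae_restrict_of_subset (Set.Icc_subset_Icc_right ht.2) huv]
      with x hx
    rw [hx]
  bounded := by
    refine ⟨(∫⁻ x, ‖(Set.Ici 0).indicator (fun y : ℝ => Complex.exp (r * y)) x‖ₑ).toNNReal,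
      fun u hu => ?_⟩
    rw [ENNReal.coe_toNNReal (lintegral_enorm_exp_lt_top hr).ne]
    have hf : MemLp ((Set.Ici 0).indicator u) 2 volume :=
      (memLp_indicator_iff_restrict measurableSet_Ici).2 hu
    have hg : Measurable ((Set.Ici 0).indicator fun y : ℝ => Complex.exp (r * y)) :=
      Measurable.indicator (by fun_prop) measurableSet_Ici
    have hle := eLpNorm_convolution_le hf.1 hg
    simp_rw [← firstOrder_eq_convolution] at hle
    rw [eLpNorm_indicator_eq_eLpNorm_restrict measurableSet_Ici] at hle
    have hle' : eLpNorm (firstOrder r u) 2 timeMeasure ≤ _ :=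
      (eLpNorm_mono_measure _ Measure.restrict_le_self).trans hle
    refine ⟨⟨?_, hle'.trans_lt (ENNReal.mul_lt_top (lintegral_enorm_exp_lt_top hr) hu.2)⟩, hle'⟩
    have hm := (hf.1.convolution_integrand (ContinuousLinearMap.mul ℂ ℂ) hg.aestronglyMeasurable
      (μ := volume) (ν := volume)).integral_prod_right'
    have hm' : AEStronglyMeasurable (firstOrder r u) volume :=
      hm.congr (ae_of_all _ fun t => (firstOrder_eq_convolution r u t).symm)
    exact hm'.mono_measure Measure.restrict_le_self
  laplace_eq _ hu _ hs := scalarLaplace_firstOrder hr hu hs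

/-- Induction on the poles: writing `p = p(r) + (s - r) p₁` gives `p / ((s - r) Q) = p₁ / Q + (s -
r)⁻¹ · p(r) / Q`. Repeated poles need no separate treatment. -/
lemma isRealizable_div_prod (S : Multiset ℂ) (hS : ∀ r ∈ S, r.re < 0) :
    ∀ p : ℂ[X], p.natDegree ≤ S.card →
      IsRealizable ℂ fun s => p.eval s / (S.map fun r => s - r).prod := by
  induction S using Multiset.induction with
  | empty =>
    intro p hp
    rw [eq_C_of_natDegree_le_zero (p := p) (by simpa using hp)]
    simpa using isRealizable_const (p.coeff 0)
  | cons r S ih =>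
    intro p hp
    have hS' := fun x hx => hS x (Multiset.mem_cons_of_mem hx)
    have hr := hS r (Multiset.mem_cons_self r S)
    have h1 := ih hS' (p /ₘ (X - C r)) (by
      rw [natDegree_divByMonic _ (monic_X_sub_C r), natDegree_X_sub_C]
      rw [Multiset.card_cons] at hp
      omega)
    have h2 := ih hS' (C (p.eval r)) (by simp)
    refine (h1.add (IsRealizable.mul ⟨_, realizes_firstOrder hr⟩ h2)).congr fun s hs => ?_
    have hne : s - r ≠ 0 := by
      intro h0
      have := congrArg Complex.re h0
      rw [Complex.sub_re, Complex.zero_re] at this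
      linarith
    have hprod : (S.map fun r => s - r).prod ≠ 0 := by
      intro h0
      obtain ⟨x, hx, hx0⟩ := Multiset.mem_map.1 (Multiset.prod_eq_zero_iff.1 h0)
      have := congrArg Complex.re hx0
      rw [Complex.sub_re, Complex.zero_re] at this
      linarith [hS' x hx]
    have hp := congrArg (eval s) (modByMonic_add_div p (X - C r))
    rw [modByMonic_X_sub_C_eq_C_eval, eval_add, eval_mul, eval_sub, eval_X, eval_C] at hp
    rw [Multiset.map_cons, Multiset.prod_cons, ← hp, eval_C, eval_C]
    field_simp
    ring

lemma isRealizable_fracVal {p q : ℝ[X]} (hq : IsHurwitz q) (hd : p.natDegree ≤ q.natDegree) :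
    IsRealizable ℂ fun s => aeval s p / aeval s q := by
  have h := isRealizable_div_prod _ (re_neg_of_mem_roots hq) (p.map (algebraMap ℝ ℂ))
    (by rwa [card_roots_map_complex, natDegree_map])
  refine (h.mul (isRealizable_const (q.leadingCoeff : ℂ)⁻¹)).congr fun s _ => ?_
  rw [aeval_eq_leadingCoeff_mul_prod_roots q, eval_map_algebraMap, div_mul_eq_div_div, div_right_comm,
    div_eq_mul_inv _ (q.leadingCoeff : ℂ)]

/-! ### Real and complex signals -/

lemma map_complex_map (z : ℂ) :
    RCLike.map 𝕜 ℂ (RCLike.map ℂ 𝕜 z) = z.re + (z.im * RCLike.im (RCLike.I : 𝕜) : ℝ) * Complex.I := by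
  simp

/-- Separates the real case (`I = 0`) from the complex case for an abstract `RCLike` field. -/
lemma im_I_eq_zero_or_one : RCLike.im (RCLike.I : 𝕜) = 0 ∨ RCLike.im (RCLike.I : 𝕜) = 1 := by
  have h := RCLike.I_im (K := 𝕜) RCLike.I
  by_cases h0 : RCLike.im (RCLike.I : 𝕜) = 0
  · exact Or.inl h0
  · exact Or.inr (mul_left_cancel₀ h0 (by rw [h, mul_one]))

lemma exists_eLpNorm_map_le {𝕜' : Type*} [RCLike 𝕜'] : ∃ C : ℝ≥0, ∀ u : ℝ → 𝕜,
    eLpNorm (fun t => RCLike.map 𝕜 𝕜' (u t)) 2 timeMeasure ≤ C * eLpNorm u 2 timeMeasure :=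
  ⟨‖RCLike.map 𝕜 𝕜'‖₊, fun _ => eLpNorm_le_nnreal_smul_eLpNorm_of_ae_le_mul
    (ae_of_all _ fun _ => (RCLike.map 𝕜 𝕜').le_opNNNorm _) 2⟩

/-- An operator on complex signals whose transfer function is real on the real axis induces an
operator on signals with values in `𝕜`. -/
lemma IsRealizable.of_complex {g : ℂ → ℂ} (h : IsRealizable ℂ g)
    (hg : ∀ s : ℂ, 0 < s.re → g (starRingEnd ℂ s) = starRingEnd ℂ (g s)) : IsRealizable 𝕜 g := by
  obtain ⟨Φ, h⟩ := h
  refine ⟨fun u t => RCLike.map ℂ 𝕜 (Φ (fun x => RCLike.map 𝕜 ℂ (u x)) t),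
    ⟨fun T u v huv => ?_, ?_, fun u hu s hs => ?_⟩⟩
  · have h1 : (fun x => RCLike.map 𝕜 ℂ (u x)) =ᵐ[volume.restrict (Set.Icc 0 T)]
        fun x => RCLike.map 𝕜 ℂ (v x) := by
      filter_upwards [huv] with x hx
      rw [hx]
    filter_upwards [h.causal T _ _ h1] with t ht
    rw [ht]
  · obtain ⟨C, hC⟩ := h.bounded
    obtain ⟨C₁, hC₁⟩ := exists_eLpNorm_map_le (𝕜 := 𝕜) (𝕜' := ℂ)
    obtain ⟨C₂, hC₂⟩ := exists_eLpNorm_map_le (𝕜 := ℂ) (𝕜' := 𝕜)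
    refine ⟨C₂ * (C * C₁), fun u hu => ⟨memLp_map (hC _ (memLp_map hu)).1, ?_⟩⟩
    refine (hC₂ _).trans ?_
    rw [ENNReal.coe_mul, ENNReal.coe_mul, mul_assoc, mul_assoc]
    gcongr
    refine (hC _ (memLp_map hu)).2.trans ?_
    gcongr
    exact hC₁ u
  · set w : ℝ → ℂ := fun x => RCLike.map 𝕜 ℂ (u x) with hw
    have hwL : MemLp w 2 timeMeasure := memLp_map hu
    have hu' : ∀ s, scalarLaplace u s = scalarLaplace w s := fun s => by
      rw [scalarLaplace_complex, scalarLaplace]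
    have hy := h.laplace_eq w hwL s hs
    rw [hu', ← hy]
    rcases im_I_eq_zero_or_one (𝕜 := 𝕜) with h0 | h1
    -- Real signals: the input is its own conjugate and `g` is symmetric, so the output and its
    -- conjugate have the same transform. Hence so does the real part, which is what the map to `𝕜`
    -- keeps.
    · have hwc : ∀ x, starRingEnd ℂ (w x) = w x := fun x => by
        rw [Complex.conj_eq_iff_im, hw]
        have := RCLike.I_im (u x)
        rw [h0, mul_zero] at this
        simp [← this]
      have hs' : 0 < (starRingEnd ℂ s).re := by simpa using hs
      have hyc : scalarLaplace (fun t => starRingEnd ℂ (Φ w t)) s = scalarLaplace (Φ w) s := by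
        rw [scalarLaplace_conj, h.laplace_eq w hwL _ hs', map_mul, hg s hs, Complex.conj_conj,
          ← scalarLaplace_conj, hy]
        simp_rw [hwc]
      have hm := h.memLp hwL
      have hmc : MemLp (fun t => starRingEnd ℂ (Φ w t)) 2 timeMeasure := hm.star
      have hadd := scalarLaplace_add hm hmc hs
      rw [hyc, ← two_mul] at hadd
      have h2 := scalarLaplace_const_mul 2⁻¹ (fun t => Φ w t + starRingEnd ℂ (Φ w t)) s
      rw [hadd, inv_mul_cancel_left₀ two_ne_zero] at h2
      rw [← h2, scalarLaplace_complex, scalarLaplace]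
      congr 1
      funext t
      rw [map_complex_map, h0, Complex.add_conj]
      push_cast
      ring
    · rw [scalarLaplace_complex, scalarLaplace]
      congr 1
      funext t
      rw [map_complex_map, h1, mul_one, Complex.re_add_im]

/-- The values of a stable rational function in the closed right half plane. -/
def stableVal (f : stableFrac Unit) (s : ℂ) : ℂ :=
  open Classical in if h : 0 ≤ s.re then evalHom () (some ⟨s, h⟩) f else 0

lemma stableVal_of_nonneg (f : stableFrac Unit) {s : ℂ} (hs : 0 ≤ s.re) :
    stableVal f s = evalHom () (some ⟨s, hs⟩) f := dif_pos hs

lemma isRealizable_stableVal (f : stableFrac Unit) : IsRealizable 𝕜 (stableVal f) := by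
  obtain ⟨q, P, hq, hd, -, hF⟩ := f.2
  have hv : ∀ s : ℂ, 0 < s.re → stableVal f s = aeval s (P ()) / aeval s q := fun s hs => by
    rw [stableVal_of_nonneg f hs.le, evalHom_apply, hF]
    rfl
  refine ((isRealizable_fracVal hq (hd ())).congr hv).of_complex fun s hs => ?_
  rw [hv s hs, hv _ (by simpa using hs), aeval_conj, aeval_conj, map_div₀]

end Realization

/-! ### Vector valued signals -/

section Vector

variable {𝕜 : Type*} [RCLike 𝕜] {n : ℕ}

lemma ae_timeMeasure_of_forall {p : ℝ → Prop}
    (h : ∀ T : ℝ, ∀ᵐ t ∂volume.restrict (Set.Icc 0 T), p t) : ∀ᵐ t ∂timeMeasure, p t := by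
  have hU : Set.Ici (0 : ℝ) = ⋃ k : ℕ, Set.Icc (0 : ℝ) k := by
    ext t
    simp only [Set.mem_Ici, Set.mem_iUnion, Set.mem_Icc]
    exact ⟨fun ht => (exists_nat_ge t).imp fun k hk => ⟨ht, hk⟩, fun ⟨_, hk⟩ => hk.1⟩
  rw [timeMeasure, hU, ae_restrict_iUnion_iff]
  exact fun k => h k

lemma restrict_Icc_le_timeMeasure (T : ℝ) : volume.restrict (Set.Icc 0 T) ≤ timeMeasure :=
  Measure.restrict_mono_set _ Set.Icc_subset_Ici_self

lemma ae_Icc_of_ae {p : ℝ → Prop} (h : ∀ᵐ t ∂timeMeasure, p t) (T : ℝ) :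
    ∀ᵐ t ∂volume.restrict (Set.Icc 0 T), p t :=
  ae_mono (restrict_Icc_le_timeMeasure T) h

variable {u v : ℝ → EuclideanSpace 𝕜 (Fin n)}

lemma IsL2.isL2e (hu : IsL2 u) : IsL2e u := fun T => hu.mono_measure (restrict_Icc_le_timeMeasure T)

lemma IsL2e.isL2_truncate (hu : IsL2e u) (T : ℝ) : IsL2 (truncate T u) := by
  rw [IsL2, truncate, memLp_indicator_iff_restrict measurableSet_Icc, timeMeasure,
    Measure.restrict_restrict measurableSet_Icc,
    Set.inter_eq_left.2 Set.Icc_subset_Ici_self]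
  exact hu T

lemma truncate_ae_eq (T : ℝ) (u : ℝ → EuclideanSpace 𝕜 (Fin n)) :
    truncate T u =ᵐ[volume.restrict (Set.Icc 0 T)] u := by
  filter_upwards [ae_restrict_mem measurableSet_Icc] with t ht
  exact Set.indicator_of_mem ht u

lemma IsL2e.congr (hu : IsL2e u) (h : u =ᵐ[timeMeasure] v) : IsL2e v := fun T =>
  (memLp_congr_ae (ae_Icc_of_ae h T)).1 (hu T)

lemma memLp_apply (hu : IsL2 u) (i : Fin n) : MemLp (fun t => u t i) 2 timeMeasure :=
  (EuclideanSpace.proj (𝕜 := 𝕜) i).comp_memLp' hu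

lemma eLpNorm_apply_le (u : ℝ → EuclideanSpace 𝕜 (Fin n)) (i : Fin n) :
    eLpNorm (fun t => u t i) 2 timeMeasure ≤ eLpNorm u 2 timeMeasure :=
  eLpNorm_mono fun t => PiLp.norm_apply_le (u t) i

lemma laplace_apply (u : ℝ → EuclideanSpace 𝕜 (Fin n)) (s : ℂ) (i : Fin n) :
    laplace u s i = scalarLaplace (fun t => u t i) s := rfl

lemma laplace_add (hu : IsL2 u) (hv : IsL2 v) {s : ℂ} (hs : 0 < s.re) :
    laplace (fun t => u t + v t) s = laplace u s + laplace v s := by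
  funext i
  exact scalarLaplace_add (memLp_apply hu i) (memLp_apply hv i) hs

lemma ae_eq_of_laplace_eq (hu : IsL2 u) (hv : IsL2 v)
    (h : ∀ s : ℂ, 0 < s.re → laplace u s = laplace v s) : u =ᵐ[timeMeasure] v := by
  have hi : ∀ i, (fun t => u t i - v t i) =ᵐ[timeMeasure] 0 := by
    intro i
    refine ae_eq_zero_of_scalarLaplace_eq_zero ((memLp_apply hu i).sub (memLp_apply hv i))
      fun s hs => ?_
    have h1 := congrFun (h s hs) i
    have h2 := scalarLaplace_add (u := fun t => u t i - v t i) (v := fun t => v t i)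
      ((memLp_apply hu i).sub (memLp_apply hv i)) (memLp_apply hv i) hs
    simp only [sub_add_cancel] at h2
    rw [laplace_apply, laplace_apply] at h1
    rw [h1] at h2
    exact left_eq_add.1 (h2.trans (add_comm _ _))
  filter_upwards [ae_all_iff.2 hi] with t ht
  ext i
  exact sub_eq_zero.1 (ht i)

lemma memLp_toLp {w : Fin n → ℝ → 𝕜} (hw : ∀ i, MemLp (w i) 2 timeMeasure) :
    IsL2 (fun t => WithLp.toLp 2 fun i => w i t) ∧
      eLpNorm (fun t => (WithLp.toLp 2 fun i => w i t : EuclideanSpace 𝕜 (Fin n))) 2 timeMeasure ≤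
        ∑ i, eLpNorm (w i) 2 timeMeasure := by
  have hs : ∀ i, MemLp (fun t => EuclideanSpace.single (𝕜 := 𝕜) i (w i t)) 2 timeMeasure := by
    intro i
    refine (hw i).of_le ?_ (ae_of_all _ fun t => ?_)
    · have hc : Continuous fun x : 𝕜 => EuclideanSpace.single (𝕜 := 𝕜) i x :=
        (PiLp.continuous_toLp 2 _).comp (continuous_single (A := fun _ : Fin n => 𝕜) i)
      exact hc.comp_aestronglyMeasurable (hw i).1
    · exact (PiLp.norm_single 2 _ i _).le
  have hsum : (fun t => (WithLp.toLp 2 fun i => w i t : EuclideanSpace 𝕜 (Fin n))) =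
      ∑ i, fun t => EuclideanSpace.single i (w i t) := by
    funext t
    ext j
    simp [Finset.sum_apply]
  rw [hsum]
  refine ⟨?_, (eLpNorm_sum_le (fun i _ => (hs i).1) one_le_two).trans
    (Finset.sum_le_sum fun i _ => ?_)⟩
  · rw [IsL2]
    exact memLp_finsetSum' _ fun i _ => hs i
  · exact (eLpNorm_congr_norm_ae (ae_of_all _ fun t => PiLp.norm_single 2 _ i _)).le

/-- The value of a stable transfer matrix in the open right half plane. -/
def matVal (M : Matrix (Fin n) (Fin n) (stableFrac Unit)) {s : ℂ} (hs : 0 < s.re) :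
    Matrix (Fin n) (Fin n) ℂ :=
  (evalHom () (some ⟨s, hs.le⟩)).mapMatrix M

/-- The operator `Φ` is causal, bounded on `L₂`, and has the transfer matrix `M`. -/
structure MatrixRealizes (M : Matrix (Fin n) (Fin n) (stableFrac Unit))
    (Φ : (ℝ → EuclideanSpace 𝕜 (Fin n)) → ℝ → EuclideanSpace 𝕜 (Fin n)) : Prop where
  causal : ∀ (T : ℝ) (u v : ℝ → EuclideanSpace 𝕜 (Fin n)),
    u =ᵐ[volume.restrict (Set.Icc 0 T)] v → Φ u =ᵐ[volume.restrict (Set.Icc 0 T)] Φ v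
  bounded : ∃ C : ℝ≥0, ∀ u, IsL2 u → IsL2 (Φ u) ∧
    eLpNorm (Φ u) 2 timeMeasure ≤ C * eLpNorm u 2 timeMeasure
  laplace_eq : ∀ u, IsL2 u → ∀ (s : ℂ) (hs : 0 < s.re),
    laplace (Φ u) s = (matVal M hs).mulVec (laplace u s)

lemma exists_matrixRealizes (M : Matrix (Fin n) (Fin n) (stableFrac Unit)) :
    ∃ Φ : (ℝ → EuclideanSpace 𝕜 (Fin n)) → ℝ → EuclideanSpace 𝕜 (Fin n), MatrixRealizes M Φ := by
  choose φ hφ using fun i j => isRealizable_stableVal (𝕜 := 𝕜) (M i j)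
  choose C hC using fun i j => (hφ i j).bounded
  have hrow : ∀ u, IsL2 u → ∀ i,
      MemLp (fun t => ∑ j, φ i j (fun x => u x j) t) 2 timeMeasure := fun u hu i =>
    memLp_finsetSum _ fun j _ => (hφ i j).memLp (memLp_apply hu j)
  refine ⟨fun u t => WithLp.toLp 2 fun i => ∑ j, φ i j (fun x => u x j) t, ⟨fun T u v huv => ?_,
    ⟨∑ i, ∑ j, C i j, fun u hu => ⟨(memLp_toLp (hrow u hu)).1, ?_⟩⟩, fun u hu s hs => ?_⟩⟩
  · have h1 : ∀ i j, φ i j (fun x => u x j) =ᵐ[volume.restrict (Set.Icc 0 T)]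
        φ i j (fun x => v x j) := fun i j => (hφ i j).causal T _ _ (by
      filter_upwards [huv] with x hx
      rw [hx])
    filter_upwards [ae_all_iff.2 fun i => ae_all_iff.2 (h1 i)] with t ht
    simp_rw [ht]
  · refine (memLp_toLp (hrow u hu)).2.trans ?_
    rw [ENNReal.ofNNReal_finsetSum, Finset.sum_mul]
    refine Finset.sum_le_sum fun i _ => ?_
    rw [ENNReal.ofNNReal_finsetSum, Finset.sum_mul]
    have hsum : (fun t => ∑ j, φ i j (fun x => u x j) t) = ∑ j, φ i j (fun x => u x j) := by
      funext t
      rw [Finset.sum_apply]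
    rw [hsum]
    refine (eLpNorm_sum_le (fun j _ => ((hφ i j).memLp (memLp_apply hu j)).1) one_le_two).trans
      (Finset.sum_le_sum fun j _ => ?_)
    refine (hC i j _ (memLp_apply hu j)).2.trans ?_
    gcongr
    exact eLpNorm_apply_le u j
  · funext i
    rw [laplace_apply]
    simp only
    rw [scalarLaplace_sum _ (fun j _ => (hφ i j).memLp (memLp_apply hu j)) hs, Matrix.mulVec,
      dotProduct]
    refine Finset.sum_congr rfl fun j _ => ?_
    rw [(hφ i j).laplace_eq _ (memLp_apply hu j) s hs, stableVal_of_nonneg _ hs.le]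
    rfl

namespace MatrixRealizes

variable {M : Matrix (Fin n) (Fin n) (stableFrac Unit)}
  {Φ : (ℝ → EuclideanSpace 𝕜 (Fin n)) → ℝ → EuclideanSpace 𝕜 (Fin n)}

lemma isL2 (h : MatrixRealizes M Φ) (hu : IsL2 u) : IsL2 (Φ u) :=
  h.bounded.elim fun _ hC => (hC u hu).1

/-- On `[0, T]` causality identifies `Φ u` with the response to the truncated input, which is in
`L₂`. -/
lemma isL2e (h : MatrixRealizes M Φ) (hu : IsL2e u) : IsL2e (Φ u) := fun T =>
  (memLp_congr_ae (h.causal T _ _ (truncate_ae_eq T u))).1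
    ((h.isL2 (hu.isL2_truncate T)).isL2e T)

lemma congr (h : MatrixRealizes M Φ) (huv : u =ᵐ[timeMeasure] v) : Φ u =ᵐ[timeMeasure] Φ v :=
  ae_timeMeasure_of_forall fun T => h.causal T u v (ae_Icc_of_ae huv T)

/-- Injectivity of the Laplace transform fixes the response to each truncation, and causality glues
these together. The relational `IsResponse` thus becomes an equation. -/
lemma isResponse_iff {H : Matrix (Fin n) (Fin n) (RatFunc ℝ)} (hH : IsRHInfty H)
    (h : MatrixRealizes (toStable Unit hH) Φ) {e y : ℝ → EuclideanSpace 𝕜 (Fin n)}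
    (he : IsL2e e) : IsResponse H e y ↔ y =ᵐ[timeMeasure] Φ e := by
  have hL : ∀ T, IsL2Response H (truncate T e) (Φ (truncate T e)) := fun T =>
    ⟨h.isL2 (he.isL2_truncate T), fun s hs => by
      rw [h.laplace_eq _ (he.isL2_truncate T) s hs, matVal, mapMatrix_evalHom_toStable]
      rfl⟩
  constructor
  · intro hy
    refine ae_timeMeasure_of_forall fun T => ?_
    obtain ⟨z, ⟨hz, hzl⟩, hyz⟩ := hy T
    have hzΦ : z =ᵐ[timeMeasure] Φ (truncate T e) :=
      ae_eq_of_laplace_eq hz (hL T).1 fun s hs => by rw [hzl s hs, (hL T).2 s hs]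
    exact (hyz.trans (ae_Icc_of_ae hzΦ T)).trans (h.causal T _ _ (truncate_ae_eq T e))
  · intro hy T
    exact ⟨_, hL T, Filter.EventuallyEq.trans (ae_Icc_of_ae hy T)
      (h.causal T _ _ (truncate_ae_eq T e)).symm⟩

end MatrixRealizes

/-! ### The feedback loop -/

section Loop

variable {M₁ M₂ R : Matrix (Fin n) (Fin n) (stableFrac Unit)}
  {Φ₁ Φ₂ Ψ : (ℝ → EuclideanSpace 𝕜 (Fin n)) → ℝ → EuclideanSpace 𝕜 (Fin n)}

lemma laplace_returnDifference (h₁ : MatrixRealizes M₁ Φ₁) (h₂ : MatrixRealizes M₂ Φ₂)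
    {e : ℝ → EuclideanSpace 𝕜 (Fin n)} (he : IsL2 e) {s : ℂ} (hs : 0 < s.re) :
    laplace (fun t => e t + Φ₂ (Φ₁ e) t) s = (matVal (1 + M₂ * M₁) hs).mulVec (laplace e s) := by
  rw [laplace_add he (h₂.isL2 (h₁.isL2 he)) hs, h₂.laplace_eq _ (h₁.isL2 he) s hs,
    h₁.laplace_eq _ he s hs, matVal, matVal, matVal, map_add, map_one, map_mul,
    Matrix.add_mulVec, Matrix.one_mulVec, Matrix.mulVec_mulVec]

lemma returnDifference_causal (h₁ : MatrixRealizes M₁ Φ₁) (h₂ : MatrixRealizes M₂ Φ₂) {T : ℝ}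
    {e e' : ℝ → EuclideanSpace 𝕜 (Fin n)} (he : e =ᵐ[volume.restrict (Set.Icc 0 T)] e') :
    (fun t => e t + Φ₂ (Φ₁ e) t) =ᵐ[volume.restrict (Set.Icc 0 T)]
      fun t => e' t + Φ₂ (Φ₁ e') t :=
  he.add (h₂.causal T _ _ (h₁.causal T _ _ he))

/-- `Ψ`, the operator with transfer matrix `(1 + M₂ M₁)⁻¹`, is a right inverse of `1 + Φ₂ Φ₁`. -/
lemma returnDifference_apply_inverse (h₁ : MatrixRealizes M₁ Φ₁) (h₂ : MatrixRealizes M₂ Φ₂)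
    (hΨ : MatrixRealizes R Ψ) (hR : (1 + M₂ * M₁) * R = 1) (hu : IsL2e u) :
    (fun t => Ψ u t + Φ₂ (Φ₁ (Ψ u)) t) =ᵐ[timeMeasure] u := by
  -- Transforms are available only for `L₂` signals, so the identity is proved for the truncated
  -- input and transferred to `[0, T]` by causality.
  refine ae_timeMeasure_of_forall fun T => ?_
  have huT := hu.isL2_truncate T
  have hp := hΨ.isL2 huT
  have h : (fun t => Ψ (truncate T u) t + Φ₂ (Φ₁ (Ψ (truncate T u))) t) =ᵐ[timeMeasure]
      truncate T u := by
    refine ae_eq_of_laplace_eq (hp.add (h₂.isL2 (h₁.isL2 hp))) huT fun s hs => ?_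
    rw [laplace_returnDifference h₁ h₂ hp hs, hΨ.laplace_eq _ huT s hs, Matrix.mulVec_mulVec,
      matVal, matVal, ← map_mul, hR, map_one, Matrix.one_mulVec]
  have h1 := returnDifference_causal h₁ h₂ (hΨ.causal T _ _ (truncate_ae_eq T u))
  exact (h1.symm.trans (ae_Icc_of_ae h T)).trans (truncate_ae_eq T u)

/-- Here `e` is truncated instead of `u`: the signal `v` produced by the truncation is in `L₂` and
agrees with `u` on `[0, T]`, though not necessarily beyond. Causality of `Ψ` makes this enough. -/
lemma ae_eq_inverse_of_returnDifference_eq (h₁ : MatrixRealizes M₁ Φ₁)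
    (h₂ : MatrixRealizes M₂ Φ₂) (hΨ : MatrixRealizes R Ψ) (hR : R * (1 + M₂ * M₁) = 1)
    {e : ℝ → EuclideanSpace 𝕜 (Fin n)} (he : IsL2e e)
    (heu : (fun t => e t + Φ₂ (Φ₁ e) t) =ᵐ[timeMeasure] u) : e =ᵐ[timeMeasure] Ψ u := by
  refine ae_timeMeasure_of_forall fun T => ?_
  have heT := he.isL2_truncate T
  set v : ℝ → EuclideanSpace 𝕜 (Fin n) :=
    fun t => truncate T e t + Φ₂ (Φ₁ (truncate T e)) t with hv
  have hvL : IsL2 v := heT.add (h₂.isL2 (h₁.isL2 heT))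
  have hvu : v =ᵐ[volume.restrict (Set.Icc 0 T)] u :=
    (returnDifference_causal h₁ h₂ (truncate_ae_eq T e)).trans (ae_Icc_of_ae heu T)
  have h : Ψ v =ᵐ[timeMeasure] truncate T e := by
    refine ae_eq_of_laplace_eq (hΨ.isL2 hvL) heT fun s hs => ?_
    rw [hΨ.laplace_eq _ hvL s hs, laplace_returnDifference h₁ h₂ heT hs, Matrix.mulVec_mulVec,
      matVal, matVal, ← map_mul, hR, map_one, Matrix.one_mulVec]
  have h1 := hΨ.causal T _ _ hvu
  have h2 : Ψ v =ᵐ[volume.restrict (Set.Icc 0 T)] truncate T e := ae_Icc_of_ae h T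
  exact (truncate_ae_eq T e).symm.trans (h2.symm.trans h1)

lemma isL2Stable_of_isUnit {H₁ H₂ : Matrix (Fin n) (Fin n) (RatFunc ℝ)} (hH₁ : IsRHInfty H₁)
    (hH₂ : IsRHInfty H₂) (hU : IsUnit (1 + toStable Unit hH₂ * toStable Unit hH₁)) :
    IsL2Stable 𝕜 H₁ H₂ := by
  obtain ⟨R, hR, hR'⟩ := isUnit_iff_exists.1 hU
  obtain ⟨Φ₁, h₁⟩ := exists_matrixRealizes (𝕜 := 𝕜) (toStable Unit hH₁)
  obtain ⟨Φ₂, h₂⟩ := exists_matrixRealizes (𝕜 := 𝕜) (toStable Unit hH₂)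
  obtain ⟨Ψ, hΨ⟩ := exists_matrixRealizes (𝕜 := 𝕜) R
  -- Eliminating `y` and `w` turns the loop into `e + Φ₂ (Φ₁ e) = u`, so uniqueness and the gain
  -- bounds follow from these formulas.
  have key : ∀ u e y : ℝ → EuclideanSpace 𝕜 (Fin n), IsLoopSolution H₁ H₂ u e y →
      e =ᵐ[timeMeasure] Ψ u ∧ y =ᵐ[timeMeasure] Φ₁ (Ψ u) := by
    rintro u e y ⟨he, hy, hye, w, hw, hwy, heq⟩
    rw [MatrixRealizes.isResponse_iff hH₁ h₁ he] at hye
    rw [MatrixRealizes.isResponse_iff hH₂ h₂ hy] at hwy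
    have heΨ : e =ᵐ[timeMeasure] Ψ u := by
      refine ae_eq_inverse_of_returnDifference_eq h₁ h₂ hΨ hR' he ?_
      filter_upwards [heq, hwy, h₂.congr hye] with t ht1 ht2 ht3
      rw [← ht3, ← ht2]
      nth_rw 1 [ht1]
      exact sub_add_cancel _ _
    exact ⟨heΨ, hye.trans (h₁.congr heΨ)⟩
  refine ⟨fun u hu => ?_, fun u e y e' y' _ h h' => ?_, ?_⟩
  · have he := hΨ.isL2e hu
    have hy := h₁.isL2e he
    refine ⟨Ψ u, Φ₁ (Ψ u), he, hy, (MatrixRealizes.isResponse_iff hH₁ h₁ he).2 (ae_eq_refl _),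
      Φ₂ (Φ₁ (Ψ u)), h₂.isL2e hy, (MatrixRealizes.isResponse_iff hH₂ h₂ hy).2 (ae_eq_refl _), ?_⟩
    filter_upwards [returnDifference_apply_inverse h₁ h₂ hΨ hR hu] with t ht
    exact eq_sub_of_add_eq ht
  · have h1 := key u e y h
    have h2 := key u e' y' h'
    exact ⟨h1.1.trans h2.1.symm, h1.2.trans h2.2.symm⟩
  · obtain ⟨C, hC⟩ := hΨ.bounded
    obtain ⟨C₁, hC₁⟩ := h₁.bounded
    refine ⟨max C (C₁ * C), fun u e y hu h => ?_⟩
    obtain ⟨hre, hry⟩ := key u e y h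
    have hle : eLpNorm e 2 timeMeasure ≤ C * eLpNorm u 2 timeMeasure := by
      rw [eLpNorm_congr_ae hre]
      exact (hC u hu).2
    have hly : eLpNorm y 2 timeMeasure ≤ (C₁ * C : ℝ≥0) * eLpNorm u 2 timeMeasure := by
      rw [eLpNorm_congr_ae hry, ENNReal.coe_mul, mul_assoc]
      refine (hC₁ _ (hC u hu).1).2.trans ?_
      gcongr
      exact (hC u hu).2
    refine ⟨(memLp_congr_ae hre).2 (hC u hu).1, (memLp_congr_ae hry).2 (hC₁ _ (hC u hu).1).1,
      hle.trans ?_, hly.trans ?_⟩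
    · gcongr
      exact le_max_left _ _
    · gcongr
      exact le_max_right _ _

end Loop

end Vector

end SmallPhase

end

theorem theorem3 (𝕜 : Type*) [RCLike 𝕜] (n : ℕ)
    (H₁ H₂ : Matrix (Fin n) (Fin n) (RatFunc ℝ))
    (hH₁ : SmallPhase.IsRHInfty H₁) (hH₂ : SmallPhase.IsRHInfty H₂)
    (hphase : ∀ ω : ℝ, 0 ≤ ω →
      SmallPhase.maxPhase (SmallPhase.evalAt H₁ (Complex.I * (ω : ℂ))) +
        SmallPhase.maxPhase (SmallPhase.evalAt H₂ (Complex.I * (ω : ℂ))) < Real.pi)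
    (hphase_infty : SmallPhase.maxPhase (SmallPhase.evalInfty H₁) +
        SmallPhase.maxPhase (SmallPhase.evalInfty H₂) < Real.pi) :
    SmallPhase.IsL2Stable 𝕜 H₁ H₂ :=
  SmallPhase.isL2Stable_of_isUnit hH₁ hH₂
    (SmallPhase.isUnit_one_add_of_maxPhase_add_lt hH₁ hH₂ hphase hphase_infty)
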